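/- Let $n\ge 0$, let $S_n$ be the symmetric group with simple reflections $s_i=(i\ \,i{+}1)$ and length function $\ell$, and let $\mathcal H=\mathcal H_n$ be its Iwahori--Hecke algebra over $\mathbb Z[\xi]$: the associative unital algebra generated by $\tilde T_{s_1},\dots,\tilde T_{s_{n-1}}$ subject to the commutation relations $\tilde T_{s_i}\tilde T_{s_j}=\tilde T_{s_j}\tilde T_{s_i}$ for $|i-j|\ge 2$, the braid relations $\tilde T_{s_i}\tilde T_{s_{i+1}}\tilde T_{s_i}=\tilde T_{s_{i+1}}\tilde T_{s_i}\tilde T_{s_{i+1}}$ and $\tilde T_{s_i}^2=1+\xi\tilde T_{s_i}$. It is free with basis $\tilde T_w$ ($w\in S_n$), where $\tilde T_w$ is the product of generators along a reduced expression of $w$. For a composition $\lambda=(\lambda_1,\dots,\lambda_r)$ of $n$ let $S_\lambda=S_{\lambda_1}\times\dots\times S_{\lambda_r}\le S_n$ be the standard parabolic subgroup, $\mathcal H_\lambda\subseteq\mathcal H$ the subalgebra generated by the $\tilde T_{s}$ with $s$ a simple reflection in $S_\lambda$, and $\pi_\lambda:\mathcal H\to\mathcal H_\lambda$ the $\mathbb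 Z[\xi]$-linear map with $\pi_\lambda(\tilde T_w)=\tilde T_w$ if $w\in S_\lambda$ and $\pi_\lambda(\tilde T_w)=0$ otherwise. Let $w_\lambda\in S_\lambda$ be the product, in increasing order of index, of the simple reflections lying in $S_\lambda$, and let $\lambda-1$ be the composition obtained from $\lambda$ by replacing each $\lambda_i>1$ by the two parts $\lambda_i-1,\,1$. For parabolic subgroups $J\le K$ of $S_n$ and $h\in\mathcal H$ put $$\mathcal N_{K,J}(h)=\sum_{d}\tilde T_{d^{-1}}\,h\,\tilde T_d,$$ the sum being over the minimal length representatives $d$ of the right cosets $Jd$ in $K$. Put $\eta_\lambda=\mathcal N_{S_{\lambda-1},1}(\tilde T_{w_\lambda})$ and $b_\lambda=\mathcal N_{S_n,S_\lambda}(\eta_\lambda)$. A partition is a composition with weakly decreasing parts. For a partition $\alpha$ of $n$ let $C_\alpha$ be the conjugacy class of elements of $S_n$ of cycle type $\alpha$. Let $\Lambda_\lambda(\alpha)$ be the set of $\lambda$-multipartitions of $\alpha$, that is, of tuples $\theta=(\theta_1,\dots,\theta_r)$ with $\theta_i$ a partition of $\lambda_i$ whose parts taken together, with multiplicity, are the parts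 of $\alpha$. Concatenating the $\theta_i$ gives a composition of $n$, by which $S_\theta$, $w_\theta$ and $\eta_\theta$ are defined; let $C_\theta$ be the conjugacy class of $w_\theta$ in $S_\lambda$, and $|C_\theta|_{S_\lambda}$ its size. **Theorem.** For every composition $\lambda$ of $n$ and every partition $\alpha$ of $n$, $$\pi_\lambda(b_\alpha)=\frac{|S_n|}{|S_\lambda|\cdot|C_\alpha|}\sum_{\theta\in\Lambda_\lambda(\alpha)}|C_\theta|_{S_\lambda}\;\mathcal N_{S_\lambda,S_\theta}(\eta_\theta).$$ The identity holds in $\mathbb Q\otimes_{\mathbb Z}\mathcal H$; moreover each coefficient $\frac{|S_n|\,|C_\theta|_{S_\lambda}}{|S_\lambda|\,|C_\alpha|}$ is an integer, and with these integer coefficients the identity holds in $\mathcal H$ itself. -/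

import Mathlib

open scoped TensorProduct Polynomial

noncomputable section

namespace SymHecke

/-! ### The symmetric group and its simple reflections -/

/-- The smaller of the two letters moved by the `i`-th simple reflection (counting from `0`). -/
def lo {n : ℕ} (i : Fin (n - 1)) : Fin n := ⟨i, by omega⟩

/-- The larger of the two letters moved by the `i`-th simple reflection. -/
def hi {n : ℕ} (i : Fin (n - 1)) : Fin n := ⟨i + 1, by omega⟩

/-- The simple reflection exchanging the adjacent letters `i` and `i + 1` (counting from `0`). -/
def simple {n : ℕ} (i : Fin (n - 1)) : Equiv.Perm (Fin n) := Equiv.swap (lo i) (hi i)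

/-- The element of the symmetric group represented by a word in the simple reflections. -/
def wordProd {n : ℕ} (l : List (Fin (n - 1))) : Equiv.Perm (Fin n) := (l.map simple).prod

/-- The length of `w`: the least number of factors in an expression of `w` as a product of simple
reflections. -/
def len {n : ℕ} (w : Equiv.Perm (Fin n)) : ℕ :=
  sInf {k | ∃ l : List (Fin (n - 1)), l.length = k ∧ wordProd l = w}

/-- A word is a reduced expression for `w`. -/
def IsReducedWord {n : ℕ} (w : Equiv.Perm (Fin n)) (l : List (Fin (n - 1))) : Prop :=
  wordProd l = w ∧ l.length = len w

@[simp] theorem wordProd_nil {n : ℕ} : wordProd ([] : List (Fin (n - 1))) = 1 := rfl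

@[simp] theorem wordProd_cons {n : ℕ} (i : Fin (n - 1)) (l : List (Fin (n - 1))) :
    wordProd (i :: l) = simple i * wordProd l := by
  simp [wordProd]

@[simp] theorem simple_mul_self {n : ℕ} (i : Fin (n - 1)) :
    (simple i : Equiv.Perm (Fin n)) * simple i = 1 := Equiv.swap_mul_self _ _

@[simp] theorem simple_inv {n : ℕ} (i : Fin (n - 1)) :
    (simple i : Equiv.Perm (Fin n))⁻¹ = simple i := Equiv.swap_inv _ _

@[simp] theorem simple_mul_cancel {n : ℕ} (i : Fin (n - 1)) (w : Equiv.Perm (Fin n)) :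
    simple i * (simple i * w) = w := by
  rw [← mul_assoc, simple_mul_self, one_mul]

@[simp] theorem mul_simple_cancel {n : ℕ} (i : Fin (n - 1)) (w : Equiv.Perm (Fin n)) :
    w * simple i * simple i = w := by
  rw [mul_assoc, simple_mul_self, mul_one]

theorem lo_lt_hi {n : ℕ} (i : Fin (n - 1)) : (lo i : Fin n) < hi i := by
  simp [lo, hi, Fin.lt_def]

@[simp] theorem simple_lo {n : ℕ} (i : Fin (n - 1)) : simple i (lo i : Fin n) = hi i :=
  Equiv.swap_apply_left _ _

@[simp] theorem simple_hi {n : ℕ} (i : Fin (n - 1)) : simple i (hi i : Fin n) = lo i :=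
  Equiv.swap_apply_right _ _

@[simp] theorem simple_simple {n : ℕ} (i : Fin (n - 1)) (a : Fin n) :
    simple i (simple i a) = a := Equiv.swap_apply_self _ _ _

theorem simple_val {n : ℕ} (i : Fin (n - 1)) (a : Fin n) :
    ((simple i a : Fin n) : ℕ) =
      if (a : ℕ) = i then (i : ℕ) + 1 else if (a : ℕ) = i + 1 then (i : ℕ) else a := by
  simp only [simple, Equiv.swap_apply_def, lo, hi, Fin.ext_iff]
  split_ifs <;> rfl

theorem simple_lt {n : ℕ} (i : Fin (n - 1)) {a b : Fin n} (hab : a < b)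
    (h : ¬ (a = lo i ∧ b = hi i)) : simple i a < simple i b := by
  simp only [lo, hi, Fin.ext_iff] at h
  rw [Fin.lt_def] at hab ⊢
  rw [simple_val, simple_val]
  split_ifs <;> omega

/-- `w` has a left descent at `i`. -/
def Desc {n : ℕ} (i : Fin (n - 1)) (w : Equiv.Perm (Fin n)) : Prop := w⁻¹ (hi i) < w⁻¹ (lo i)

theorem desc_simple_mul {n : ℕ} (i : Fin (n - 1)) (w : Equiv.Perm (Fin n)) :
    Desc i (simple i * w) ↔ ¬ Desc i w := by
  have h : w⁻¹ (lo i) ≠ w⁻¹ (hi i) := fun h => (lo_lt_hi i).ne (w⁻¹.injective h)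
  simp only [Desc, mul_inv_rev, simple_inv, Equiv.Perm.mul_apply, simple_lo, simple_hi, not_lt]
  exact ⟨le_of_lt, fun h' => lt_of_le_of_ne h' h⟩

/-- The number of inversions of `w⁻¹`. -/
def invCount {n : ℕ} (w : Equiv.Perm (Fin n)) : ℕ :=
  (Finset.univ.filter fun p : Fin n × Fin n => p.1 < p.2 ∧ w⁻¹ p.2 < w⁻¹ p.1).card

theorem invCount_simple_mul {n : ℕ} (i : Fin (n - 1)) (w : Equiv.Perm (Fin n)) (h : ¬ Desc i w) :
    invCount (simple i * w) = invCount w + 1 := by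
  classical
  have hmem : ((lo i : Fin n), (hi i : Fin n)) ∉
      ((Finset.univ.filter fun p : Fin n × Fin n => p.1 < p.2 ∧ w⁻¹ p.2 < w⁻¹ p.1).image
        fun p => (simple i p.1, simple i p.2)) := by
    simp only [Finset.mem_image, Finset.mem_filter, Finset.mem_univ, true_and, Prod.mk.injEq,
      Prod.exists, not_exists]
    rintro a b ⟨⟨hab, -⟩, ha, hb⟩
    have ha' : a = hi i := by rw [← simple_simple i a, ha, simple_lo]
    have hb' : b = lo i := by rw [← simple_simple i b, hb, simple_hi]
    subst ha' hb'
    exact absurd hab (lo_lt_hi i).not_gt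
  have hinj : Function.Injective fun p : Fin n × Fin n => (simple i p.1, simple i p.2) := by
    rintro ⟨a, b⟩ ⟨c, d⟩ hh
    simpa using hh
  unfold invCount
  rw [← Finset.card_image_of_injective
      (Finset.univ.filter fun p : Fin n × Fin n => p.1 < p.2 ∧ w⁻¹ p.2 < w⁻¹ p.1) hinj,
    ← Finset.card_insert_of_notMem hmem]
  congr 1
  ext ⟨a, b⟩
  simp only [Finset.mem_filter, Finset.mem_univ, true_and, Finset.mem_insert, Finset.mem_image,
    Prod.mk.injEq, Prod.exists, mul_inv_rev, simple_inv, Equiv.Perm.mul_apply]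
  constructor
  · rintro ⟨hab, hw⟩
    by_cases hc : a = lo i ∧ b = hi i
    · exact Or.inl hc
    · exact Or.inr ⟨simple i a, simple i b, ⟨simple_lt i hab hc, hw⟩, by simp, by simp⟩
  · rintro (⟨rfl, rfl⟩ | ⟨c, d, ⟨hcd, hw⟩, rfl, rfl⟩)
    · refine ⟨lo_lt_hi i, ?_⟩
      simpa [Desc] using (desc_simple_mul i w).2 h
    · refine ⟨simple_lt i hcd ?_, by simpa using hw⟩
      rintro ⟨rfl, rfl⟩
      exact h hw

theorem invCount_of_desc {n : ℕ} (i : Fin (n - 1)) (w : Equiv.Perm (Fin n)) (h : Desc i w) :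
    invCount w = invCount (simple i * w) + 1 := by
  have := invCount_simple_mul i (simple i * w) (by rw [desc_simple_mul]; exact not_not.2 h)
  rwa [simple_mul_cancel] at this

theorem invCount_one {n : ℕ} : invCount (1 : Equiv.Perm (Fin n)) = 0 := by
  rw [invCount, Finset.card_eq_zero, Finset.filter_eq_empty_iff]
  rintro ⟨a, b⟩ -
  simpa using fun h : a < b => h.le

theorem invCount_wordProd_le {n : ℕ} (l : List (Fin (n - 1))) :
    invCount (wordProd l) ≤ l.length := by
  induction l with
  | nil => simp [invCount_one]
  | cons i l ih =>
    rw [wordProd_cons, List.length_cons]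
    by_cases h : Desc i (wordProd l)
    · have := invCount_of_desc i _ h
      omega
    · have := invCount_simple_mul i _ h
      omega

theorem eq_one_of_no_desc {n : ℕ} (w : Equiv.Perm (Fin n)) (h : ∀ i, ¬ Desc i w) : w = 1 := by
  cases n with
  | zero => exact Subsingleton.elim _ _
  | succ m =>
    have hmono : StrictMono (w⁻¹ : Equiv.Perm (Fin (m + 1))) := by
      rw [Fin.strictMono_iff_lt_succ]
      intro i
      have h1 := h i
      have h2 : w⁻¹ i.castSucc ≠ w⁻¹ i.succ := fun h => by
        have := w⁻¹.injective h
        simp [Fin.ext_iff] at this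
      exact lt_of_le_of_ne (not_lt.1 h1) h2
    have h3 : w⁻¹ = 1 := by
      have e : Fin (m + 1) ≃o Fin (m + 1) :=
        { toEquiv := w⁻¹, map_rel_iff' := hmono.le_iff_le }
      have h4 : ({ toEquiv := w⁻¹, map_rel_iff' := hmono.le_iff_le } :
        Fin (m + 1) ≃o Fin (m + 1)) = OrderIso.refl _ := Subsingleton.elim _ _
      ext1 x
      exact DFunLike.congr_fun h4 x
    exact inv_eq_one.1 h3

theorem exists_word {n : ℕ} (w : Equiv.Perm (Fin n)) :
    ∃ l : List (Fin (n - 1)), l.length = invCount w ∧ wordProd l = w := by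
  induction hk : invCount w using Nat.strong_induction_on generalizing w with
  | _ k ih =>
    by_cases h : ∀ i, ¬ Desc i w
    · have := eq_one_of_no_desc w h
      subst this
      exact ⟨[], by rw [← hk, invCount_one]; rfl, rfl⟩
    · push Not at h
      obtain ⟨i, hi⟩ := h
      have h1 := invCount_of_desc i w hi
      obtain ⟨l, hl, hw⟩ := ih _ (by omega) (simple i * w) rfl
      exact ⟨i :: l, by rw [List.length_cons]; omega, by rw [wordProd_cons, hw, simple_mul_cancel]⟩

theorem len_eq_invCount {n : ℕ} (w : Equiv.Perm (Fin n)) : len w = invCount w := by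
  apply le_antisymm
  · exact Nat.sInf_le (exists_word w)
  · refine le_csInf ⟨_, exists_word w⟩ ?_
    rintro k ⟨l, rfl, rfl⟩
    exact invCount_wordProd_le l

theorem exists_reducedWord {n : ℕ} (w : Equiv.Perm (Fin n)) :
    ∃ l : List (Fin (n - 1)), IsReducedWord w l := by
  obtain ⟨l, h1, h2⟩ := exists_word w
  exact ⟨l, h2, by rw [h1, len_eq_invCount]⟩

theorem perm_induction {n : ℕ} {P : Equiv.Perm (Fin n) → Prop} (h1 : P 1)
    (hs : ∀ i w, P w → P (simple i * w)) (w : Equiv.Perm (Fin n)) : P w := by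
  obtain ⟨l, -, rfl⟩ := exists_word w
  induction l with
  | nil => exact h1
  | cons i l ih => rw [wordProd_cons]; exact hs _ _ ih

/-! ### The Hecke algebra -/

/-- The defining relations of the Iwahori-Hecke algebra of the symmetric group on `n` letters, with
normalised generators, over `ℤ[ξ]`, the polynomial variable playing the role of `ξ`. -/
inductive Rel (n : ℕ) :
    FreeAlgebra ℤ[X] (Fin (n - 1)) → FreeAlgebra ℤ[X] (Fin (n - 1)) → Prop
  | comm (i j : Fin (n - 1)) (h : (i : ℕ) + 2 ≤ j) :
      Rel n (FreeAlgebra.ι _ i * FreeAlgebra.ι _ j) (FreeAlgebra.ι _ j * FreeAlgebra.ι _ i)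
  | braid (i j : Fin (n - 1)) (h : (i : ℕ) + 1 = j) :
      Rel n (FreeAlgebra.ι _ i * FreeAlgebra.ι _ j * FreeAlgebra.ι _ i)
        (FreeAlgebra.ι _ j * FreeAlgebra.ι _ i * FreeAlgebra.ι _ j)
  | quad (i : Fin (n - 1)) :
      Rel n (FreeAlgebra.ι _ i * FreeAlgebra.ι _ i)
        (1 + (Polynomial.X : ℤ[X]) • FreeAlgebra.ι _ i)

/-- The Iwahori-Hecke algebra of the symmetric group on `n` letters over `ℤ[ξ]`, by generators and
relations. -/
def Hecke (n : ℕ) : Type := RingQuot (Rel n)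

instance (n : ℕ) : Ring (Hecke n) := inferInstanceAs (Ring (RingQuot (Rel n)))

instance (n : ℕ) : Algebra ℤ[X] (Hecke n) := inferInstanceAs (Algebra ℤ[X] (RingQuot (Rel n)))

/-- The quotient map from the free algebra to the Hecke algebra. -/
def heckeMk (n : ℕ) : FreeAlgebra ℤ[X] (Fin (n - 1)) →ₐ[ℤ[X]] Hecke n :=
  RingQuot.mkAlgHom ℤ[X] (Rel n)

/-- The generator of the Hecke algebra belonging to the `i`-th simple reflection. -/
def gen {n : ℕ} (i : Fin (n - 1)) : Hecke n := heckeMk n (FreeAlgebra.ι _ i)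

/-- The product of generators along a word. -/
def wordGen {n : ℕ} (l : List (Fin (n - 1))) : Hecke n := (l.map gen).prod

/-- The element `T_w`: the product of the generators along a reduced expression for `w`. It does not
depend on the reduced expression, see `T_eq_of_isReducedWord`. -/
def T {n : ℕ} (w : Equiv.Perm (Fin n)) : Hecke n := wordGen (exists_reducedWord w).choose

theorem gen_comm {n : ℕ} (i j : Fin (n - 1)) (h : (i : ℕ) + 2 ≤ j) :
    (gen i : Hecke n) * gen j = gen j * gen i := by
  have h := RingQuot.mkAlgHom_rel ℤ[X] (Rel.comm i j h)
  rw [map_mul, map_mul] at h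
  exact h

theorem gen_braid {n : ℕ} (i j : Fin (n - 1)) (h : (i : ℕ) + 1 = j) :
    (gen i : Hecke n) * gen j * gen i = gen j * gen i * gen j := by
  have h := RingQuot.mkAlgHom_rel ℤ[X] (Rel.braid i j h)
  rw [map_mul, map_mul, map_mul, map_mul] at h
  exact h

theorem gen_quad {n : ℕ} (i : Fin (n - 1)) :
    (gen i : Hecke n) * gen i = 1 + (Polynomial.X : ℤ[X]) • gen i := by
  have h := RingQuot.mkAlgHom_rel ℤ[X] (Rel.quad (n := n) i)
  rw [map_mul, map_add, map_one, map_smul] at h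
  exact h

/-! ### The action on the free module with basis the symmetric group -/

/-- The free module with basis the symmetric group. -/
abbrev FreeMod (n : ℕ) : Type := Equiv.Perm (Fin n) →₀ ℤ[X]

/-- A basis vector of the free module. -/
def e {n : ℕ} (w : Equiv.Perm (Fin n)) : FreeMod n := Finsupp.single w 1

open Classical in
/-- `X` if the proposition holds, and `0` otherwise. -/
def xi (p : Prop) : ℤ[X] := if p then Polynomial.X else 0

/-- Left multiplication by a generator, on the free module. -/
def lop {n : ℕ} (i : Fin (n - 1)) : FreeMod n →ₗ[ℤ[X]] FreeMod n :=
  Finsupp.linearCombination ℤ[X] fun w => e (simple i * w) + xi (Desc i w) • e w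

/-- Right multiplication by a generator, on the free module. -/
def rop {n : ℕ} (j : Fin (n - 1)) : FreeMod n →ₗ[ℤ[X]] FreeMod n :=
  Finsupp.linearCombination ℤ[X] fun w => e (w * simple j) + xi (Desc j w⁻¹) • e w

theorem lop_e {n : ℕ} (i : Fin (n - 1)) (w : Equiv.Perm (Fin n)) :
    lop i (e w) = e (simple i * w) + xi (Desc i w) • e w := by
  simp [lop, e]

theorem rop_e {n : ℕ} (j : Fin (n - 1)) (w : Equiv.Perm (Fin n)) :
    rop j (e w) = e (w * simple j) + xi (Desc j w⁻¹) • e w := by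
  simp [rop, e]

theorem freeMod_ext {n : ℕ} {A B : FreeMod n →ₗ[ℤ[X]] FreeMod n}
    (h : ∀ w, A (e w) = B (e w)) : A = B :=
  Finsupp.lhom_ext' fun w => LinearMap.ext_ring (h w)

theorem xi_desc_simple_mul {n : ℕ} (i : Fin (n - 1)) (w : Equiv.Perm (Fin n)) :
    xi (Desc i (simple i * w)) = Polynomial.X - xi (Desc i w) := by
  rw [desc_simple_mul]
  by_cases h : Desc i w <;> simp [xi, h]

theorem simple_eq_conj {n : ℕ} (i j : Fin (n - 1)) (w : Equiv.Perm (Fin n))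
    (h : (w (lo j) = lo i ∧ w (hi j) = hi i) ∨ (w (lo j) = hi i ∧ w (hi j) = lo i)) :
    simple i * w = w * simple j := by
  have h1 : w * simple j * w⁻¹ = Equiv.swap (w (lo j)) (w (hi j)) := by
    rw [simple, Equiv.swap_apply_apply]
  have h2 : w * simple j * w⁻¹ = simple i := by
    rw [h1]
    rcases h with ⟨h3, h4⟩ | ⟨h3, h4⟩
    · rw [h3, h4, simple]
    · rw [h3, h4, simple, Equiv.swap_comm]
  rw [← h2]
  group

theorem desc_mul_simple {n : ℕ} (i j : Fin (n - 1)) (w : Equiv.Perm (Fin n))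
    (h : simple i * w ≠ w * simple j) : Desc i (w * simple j) ↔ Desc i w := by
  simp only [Desc, mul_inv_rev, simple_inv, Equiv.Perm.mul_apply]
  have key : ∀ a b : Fin n, a < b → ¬ (a = lo j ∧ b = hi j) → simple j a < simple j b :=
    fun a b => simple_lt j
  have h1 : ¬ (w⁻¹ (lo i) = lo j ∧ w⁻¹ (hi i) = hi j) := by
    rintro ⟨h1, h2⟩
    exact h (simple_eq_conj i j w (Or.inl ⟨by rw [← h1]; simp, by rw [← h2]; simp⟩))
  have h2 : ¬ (w⁻¹ (hi i) = lo j ∧ w⁻¹ (lo i) = hi j) := by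
    rintro ⟨h1, h2⟩
    exact h (simple_eq_conj i j w (Or.inr ⟨by rw [← h1]; simp, by rw [← h2]; simp⟩))
  constructor
  · intro h3
    by_contra h4
    have h5 : w⁻¹ (lo i) ≠ w⁻¹ (hi i) := fun h => (lo_lt_hi i).ne (w⁻¹.injective h)
    exact absurd (key _ _ (lt_of_le_of_ne (not_lt.1 h4) h5) h1) h3.not_gt
  · intro h3
    exact key _ _ h3 h2

theorem desc_inv_simple_mul {n : ℕ} (i j : Fin (n - 1)) (w : Equiv.Perm (Fin n))
    (h : simple i * w ≠ w * simple j) : Desc j (simple i * w)⁻¹ ↔ Desc j w⁻¹ := by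
  rw [mul_inv_rev, simple_inv]
  apply desc_mul_simple
  intro h1
  apply h
  have := congrArg (fun x => x⁻¹) h1
  simpa using this.symm

theorem desc_of_conj {n : ℕ} (i j : Fin (n - 1)) (w : Equiv.Perm (Fin n))
    (h : simple i * w = w * simple j) : Desc i w ↔ Desc j w⁻¹ := by
  have h1 : Equiv.swap (w (lo j)) (w (hi j)) = simple i := by
    rw [Equiv.swap_apply_apply]
    change w * simple j * w⁻¹ = _
    rw [← h, mul_inv_cancel_right]
  have h2 : w (lo j) ≠ w (hi j) := fun h => (lo_lt_hi j).ne (w.injective h)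
  have h3 : w (lo j) = lo i ∧ w (hi j) = hi i ∨ w (lo j) = hi i ∧ w (hi j) = lo i := by
    have h4 : simple i (w (lo j)) = w (hi j) := by rw [← h1, Equiv.swap_apply_left]
    by_cases ha : w (lo j) = lo i
    · left; refine ⟨ha, ?_⟩; rw [← h4, ha, simple_lo]
    · by_cases hb : w (lo j) = hi i
      · right; refine ⟨hb, ?_⟩; rw [← h4, hb, simple_hi]
      · exfalso
        rw [simple, Equiv.swap_apply_of_ne_of_ne ha hb] at h4
        exact h2 h4
  have hj := lo_lt_hi j
  have hi' := lo_lt_hi i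
  simp only [Desc, inv_inv]
  rcases h3 with ⟨h4, h5⟩ | ⟨h4, h5⟩
  · have h6 : w⁻¹ (lo i) = lo j := by rw [← h4]; simp
    have h7 : w⁻¹ (hi i) = hi j := by rw [← h5]; simp
    rw [h4, h5, h6, h7]
    exact ⟨fun h => absurd h hj.not_gt, fun h => absurd h hi'.not_gt⟩
  · have h6 : w⁻¹ (hi i) = lo j := by rw [← h4]; simp
    have h7 : w⁻¹ (lo i) = hi j := by rw [← h5]; simp
    rw [h4, h5, h6, h7]
    exact ⟨fun _ => hi', fun _ => hj⟩

theorem lop_rop {n : ℕ} (i j : Fin (n - 1)) (m : FreeMod n) :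
    lop i (rop j m) = rop j (lop i m) := by
  have : (lop i ∘ₗ rop j : FreeMod n →ₗ[ℤ[X]] FreeMod n) = rop j ∘ₗ lop i := by
    apply freeMod_ext
    intro w
    simp only [LinearMap.comp_apply, lop_e, rop_e, map_add, map_smul, smul_add, mul_assoc]
    by_cases h : simple i * w = w * simple j
    · have h1 : xi (Desc j (simple i * w)⁻¹) = Polynomial.X - xi (Desc j w⁻¹) := by
        rw [h, mul_inv_rev, simple_inv, xi_desc_simple_mul]
      have h2 : xi (Desc i (w * simple j)) = Polynomial.X - xi (Desc i w) := by
        rw [← h, xi_desc_simple_mul]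
      rw [h1, h2, desc_of_conj i j w h, h]
    · rw [desc_mul_simple i j w h, desc_inv_simple_mul i j w h, smul_smul, smul_smul,
        mul_comm (xi (Desc j w⁻¹))]
      abel
  exact LinearMap.congr_fun this m

theorem lop_ext {n : ℕ} {A B : FreeMod n →ₗ[ℤ[X]] FreeMod n}
    (hA : ∀ j m, A (rop j m) = rop j (A m)) (hB : ∀ j m, B (rop j m) = rop j (B m))
    (h : A (e 1) = B (e 1)) : A = B := by
  apply freeMod_ext
  intro w
  have key : ∀ v : Equiv.Perm (Fin n), A (e v⁻¹) = B (e v⁻¹) := by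
    intro v
    induction v using perm_induction with
    | h1 => simpa using h
    | hs i v ih =>
      have h1 : (e (simple i * v)⁻¹ : FreeMod n) = rop i (e v⁻¹) - xi (Desc i v) • e v⁻¹ := by
        rw [rop_e, inv_inv, mul_inv_rev, simple_inv, add_sub_cancel_right]
      rw [h1, map_sub, map_sub, map_smul, map_smul, hA, hB, ih]
  simpa using key w⁻¹

theorem not_desc_one {n : ℕ} (i : Fin (n - 1)) : ¬ Desc i (1 : Equiv.Perm (Fin n)) := by
  simpa [Desc] using (lo_lt_hi i).le

theorem lop_e_of_not_desc {n : ℕ} (i : Fin (n - 1)) (w : Equiv.Perm (Fin n)) (h : ¬ Desc i w) :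
    lop i (e w) = e (simple i * w) := by
  simp [lop_e, xi, h]

theorem lop_quad {n : ℕ} (i : Fin (n - 1)) :
    (lop i * lop i : Module.End ℤ[X] (FreeMod n)) = 1 + (Polynomial.X : ℤ[X]) • lop i := by
  apply lop_ext
  · intro j m; simp [lop_rop]
  · intro j m; simp [lop_rop]
  · have h : Desc i (simple i * (1 : Equiv.Perm (Fin n))) := by
      rw [desc_simple_mul]; exact not_desc_one i
    simp only [Module.End.mul_apply, LinearMap.add_apply, Module.End.one_apply,
      LinearMap.smul_apply, lop_e_of_not_desc i 1 (not_desc_one i)]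
    rw [lop_e, simple_mul_cancel]
    simp only [xi, h, if_true]

theorem lop_comm {n : ℕ} (i j : Fin (n - 1)) (h : (i : ℕ) + 2 ≤ j) :
    (lop i * lop j : Module.End ℤ[X] (FreeMod n)) = lop j * lop i := by
  apply lop_ext
  · intro j m; simp [lop_rop]
  · intro j m; simp [lop_rop]
  · have h1 : ¬ Desc i (simple j * (1 : Equiv.Perm (Fin n))) := by
      simp only [Desc, mul_one, simple_inv, Fin.lt_def, simple_val, lo, hi]
      split_ifs <;> omega
    have h2 : ¬ Desc j (simple i * (1 : Equiv.Perm (Fin n))) := by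
      simp only [Desc, mul_one, simple_inv, Fin.lt_def, simple_val, lo, hi]
      split_ifs <;> omega
    simp only [Module.End.mul_apply]
    rw [lop_e_of_not_desc _ _ (not_desc_one _), lop_e_of_not_desc _ _ (not_desc_one _),
      lop_e_of_not_desc _ _ h1, lop_e_of_not_desc _ _ h2]
    congr 1
    ext a
    simp only [Equiv.Perm.mul_apply, simple_val, Equiv.Perm.one_apply]
    split_ifs <;> omega

theorem lop_braid {n : ℕ} (i j : Fin (n - 1)) (h : (i : ℕ) + 1 = j) :
    (lop i * lop j * lop i : Module.End ℤ[X] (FreeMod n)) = lop j * lop i * lop j := by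
  apply lop_ext
  · intro j m; simp [lop_rop]
  · intro j m; simp [lop_rop]
  · have h1 : ¬ Desc i (simple j * (1 : Equiv.Perm (Fin n))) := by
      simp only [Desc, mul_one, simple_inv, Fin.lt_def, simple_val, lo, hi]
      split_ifs <;> omega
    have h2 : ¬ Desc j (simple i * (1 : Equiv.Perm (Fin n))) := by
      simp only [Desc, mul_one, simple_inv, Fin.lt_def, simple_val, lo, hi]
      split_ifs <;> omega
    have h3 : ¬ Desc i (simple j * (simple i * (1 : Equiv.Perm (Fin n)))) := by
      simp only [Desc, mul_one, mul_inv_rev, simple_inv, Equiv.Perm.mul_apply, Fin.lt_def,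
        simple_val, lo, hi]
      split_ifs <;> omega
    have h4 : ¬ Desc j (simple i * (simple j * (1 : Equiv.Perm (Fin n)))) := by
      simp only [Desc, mul_one, mul_inv_rev, simple_inv, Equiv.Perm.mul_apply, Fin.lt_def,
        simple_val, lo, hi]
      split_ifs <;> omega
    simp only [Module.End.mul_apply]
    rw [lop_e_of_not_desc _ _ (not_desc_one _), lop_e_of_not_desc _ _ (not_desc_one _),
      lop_e_of_not_desc _ _ h1, lop_e_of_not_desc _ _ h2, lop_e_of_not_desc _ _ h3,
      lop_e_of_not_desc _ _ h4]
    congr 1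
    ext a
    simp only [Equiv.Perm.mul_apply, simple_val, Equiv.Perm.one_apply, ← h]
    have e1 : (i : ℕ) + 1 + 1 ≠ i := by omega
    have e2 : (i : ℕ) ≠ i + 1 + 1 := by omega
    by_cases c1 : (a : ℕ) = i
    · simp [c1, e1, e2]
    by_cases c2 : (a : ℕ) = i + 1
    · simp [c2, e1, e2]
    by_cases c3 : (a : ℕ) = i + 1 + 1
    · simp [c3, e1, e2]
    · simp [c1, c2, c3]

/-- The representation of the Hecke algebra on the free module. -/
def rep (n : ℕ) : Hecke n →ₐ[ℤ[X]] Module.End ℤ[X] (FreeMod n) :=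
  RingQuot.liftAlgHom ℤ[X] ⟨FreeAlgebra.lift ℤ[X] lop, by
    intro x y h
    induction h with
    | comm i j h => simpa using lop_comm i j h
    | braid i j h => simpa using lop_braid i j h
    | quad i => simpa using lop_quad i⟩

theorem rep_gen {n : ℕ} (i : Fin (n - 1)) : rep n (gen i) = lop i := by
  have h := RingQuot.liftAlgHom_mkAlgHom_apply ℤ[X] (FreeAlgebra.lift ℤ[X] (lop (n := n)))
    (s := Rel n) (by
    intro x y h
    induction h with
    | comm i j h => simpa using lop_comm i j h
    | braid i j h => simpa using lop_braid i j h
    | quad i => simpa using lop_quad i) (FreeAlgebra.ι _ i)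
  rw [FreeAlgebra.lift_ι_apply] at h
  exact h

/-- The orbit map of the basis vector at the identity. -/
def orbitMap (n : ℕ) : Hecke n →ₗ[ℤ[X]] FreeMod n :=
  LinearMap.applyₗ (e 1) ∘ₗ (rep n).toLinearMap

theorem orbitMap_one (n : ℕ) : orbitMap n 1 = e 1 := by
  simp [orbitMap]

theorem orbitMap_gen_mul {n : ℕ} (i : Fin (n - 1)) (x : Hecke n) :
    orbitMap n (gen i * x) = lop i (orbitMap n x) := by
  simp [orbitMap, rep_gen]

theorem orbitMap_wordGen {n : ℕ} (l : List (Fin (n - 1)))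
    (hl : l.length = invCount (wordProd l)) : orbitMap n (wordGen l) = e (wordProd l) := by
  induction l with
  | nil => simp [wordGen, orbitMap_one]
  | cons i l ih =>
    have h1 := invCount_wordProd_le l
    rw [List.length_cons, wordProd_cons] at hl
    have h2 : ¬ Desc i (wordProd l) := by
      intro h2
      have := invCount_of_desc i _ h2
      omega
    have h3 := invCount_simple_mul i _ h2
    have h4 : wordGen (i :: l) = (gen i : Hecke n) * wordGen l := by simp [wordGen]
    rw [h4, orbitMap_gen_mul, ih (by omega), lop_e_of_not_desc _ _ h2, wordProd_cons]

theorem orbitMap_of_isReducedWord {n : ℕ} {w : Equiv.Perm (Fin n)} {l : List (Fin (n - 1))}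
    (h : IsReducedWord w l) : orbitMap n (wordGen l) = e w := by
  obtain ⟨rfl, h2⟩ := h
  exact orbitMap_wordGen l (by rw [h2, len_eq_invCount])

theorem orbitMap_T {n : ℕ} (w : Equiv.Perm (Fin n)) : orbitMap n (T w) = e w :=
  orbitMap_of_isReducedWord (exists_reducedWord w).choose_spec

/-! ### The elements `T_w` form a basis -/

section Spanning

/-- `cprod t b m = t (b + m - 1) * ⋯ * t (b + 1) * t b`, with `m` factors. -/
def cprod {A : Type} [Ring A] (t : ℕ → A) (b : ℕ) : ℕ → A
  | 0 => 1
  | m + 1 => t (b + m) * cprod t b m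

theorem cprod_mul {A : Type} [Ring A] (t : ℕ → A) (b m : ℕ) :
    cprod t (b + 1) m * t b = cprod t b (m + 1) := by
  induction m with
  | zero => simp [cprod]
  | succ m ih =>
    rw [cprod, mul_assoc, ih, show b + 1 + m = b + (m + 1) by omega]
    rfl

theorem cprod_comm {A : Type} [Ring A] (t : ℕ → A) (N : ℕ)
    (hcomm : ∀ i j, i + 2 ≤ j → j < N → t i * t j = t j * t i) (b m i : ℕ)
    (h : b + m ≤ N) (hi : i + 2 ≤ b ∨ (b + m + 1 ≤ i ∧ i < N)) :
    cprod t b m * t i = t i * cprod t b m := by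
  induction m with
  | zero => simp [cprod]
  | succ m ih =>
    have h1 : t (b + m) * t i = t i * t (b + m) := by
      rcases hi with hi | ⟨hi, hi'⟩
      · exact (hcomm i (b + m) (by omega) (by omega)).symm
      · exact hcomm (b + m) i (by omega) (by omega)
    rw [cprod, mul_assoc, ih (by omega) (by omega), ← mul_assoc, h1, mul_assoc]

theorem cprod_shift {A : Type} [Ring A] (t : ℕ → A) (N : ℕ)
    (hcomm : ∀ i j, i + 2 ≤ j → j < N → t i * t j = t j * t i)
    (hbraid : ∀ i, i + 1 < N → t i * t (i + 1) * t i = t (i + 1) * t i * t (i + 1))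
    (b m j : ℕ) (h : b + m ≤ N) (h1 : b ≤ j) (h2 : j + 1 < b + m) :
    cprod t b m * t (j + 1) = t j * cprod t b m := by
  induction m with
  | zero => omega
  | succ m ih =>
    by_cases hj : j + 1 < b + m
    · have h3 := hcomm j (b + m) (by omega) (by omega)
      rw [cprod, mul_assoc, ih (by omega) hj, ← mul_assoc, ← h3, mul_assoc]
    · cases m with
      | zero => omega
      | succ m =>
        have hjm : b + m = j := by omega
        have hjm' : b + (m + 1) = j + 1 := by omega
        have h3 := cprod_comm t N hcomm b m (j + 1) (by omega) (by omega)
        have h4 := hbraid j (by omega)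
        simp only [cprod, hjm, hjm']
        calc t (j + 1) * (t j * cprod t b m) * t (j + 1)
            = t (j + 1) * t j * (cprod t b m * t (j + 1)) := by simp only [mul_assoc]
          _ = t (j + 1) * t j * t (j + 1) * cprod t b m := by rw [h3]; simp only [mul_assoc]
          _ = t j * (t (j + 1) * (t j * cprod t b m)) := by rw [← h4]; simp only [mul_assoc]

theorem exists_spanning {R A : Type} [CommRing R] [Ring A] [Algebra R A] (t : ℕ → A) (N : ℕ)
    (x : R) (hcomm : ∀ i j, i + 2 ≤ j → j < N → t i * t j = t j * t i)
    (hbraid : ∀ i, i + 1 < N → t i * t (i + 1) * t i = t (i + 1) * t i * t (i + 1))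
    (hquad : ∀ i, i < N → t i * t i = 1 + x • t i) (k : ℕ) (hk : k ≤ N) :
    ∃ F : Finset A, F.card ≤ (k + 1).factorial ∧ (1 : A) ∈ Submodule.span R (F : Set A) ∧
      ∀ a ∈ Submodule.span R (F : Set A), ∀ i < k, a * t i ∈ Submodule.span R (F : Set A) := by
  classical
  induction k with
  | zero =>
    exact ⟨{1}, by simp, Submodule.subset_span (by simp), fun a _ i hi => absurd hi (by omega)⟩
  | succ k ih =>
    obtain ⟨F, hF, h1, hmul⟩ := ih (by omega)
    set G : Finset A := (F ×ˢ Finset.range (k + 2)).image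
      fun p => p.1 * cprod t (k + 1 - p.2) p.2 with hG
    have hmem : ∀ a ∈ Submodule.span R (F : Set A), ∀ b m, b + m = k + 1 →
        a * cprod t b m ∈ Submodule.span R (G : Set A) := by
      intro a ha b m hbm
      induction ha using Submodule.span_induction with
      | mem a ha =>
        apply Submodule.subset_span
        rw [hG]
        refine Finset.mem_coe.2 (Finset.mem_image.2 ⟨(a, m), ?_, ?_⟩)
        · simp only [Finset.mem_product, Finset.mem_range]
          exact ⟨ha, by omega⟩
        · simp only
          rw [show k + 1 - m = b by omega]
      | zero => simp
      | add a c _ _ ha hc => rw [add_mul]; exact add_mem ha hc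
      | smul r a _ ha => rw [smul_mul_assoc]; exact Submodule.smul_mem _ _ ha
    have hmem' : ∀ a ∈ Submodule.span R (F : Set A), ∀ b m, b + m = k + 1 → ∀ i < k + 1,
        a * cprod t b m * t i ∈ Submodule.span R (G : Set A) := by
      intro a ha b m hbm i hi
      rw [mul_assoc]
      by_cases c1 : i + 2 ≤ b
      · rw [cprod_comm t N hcomm b m i (by omega) (Or.inl c1), ← mul_assoc]
        exact hmem _ (hmul a ha i (by omega)) b m hbm
      by_cases c2 : i + 1 = b
      · subst c2
        rw [cprod_mul]
        exact hmem a ha i (m + 1) (by omega)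
      by_cases c3 : i = b
      · subst c3
        obtain ⟨m, rfl⟩ : ∃ m', m = m' + 1 := ⟨m - 1, by omega⟩
        rw [← cprod_mul, mul_assoc, hquad i (by omega), mul_add, mul_one, mul_smul_comm,
          cprod_mul, mul_add, mul_smul_comm]
        exact add_mem (hmem a ha (i + 1) m (by omega))
          (Submodule.smul_mem _ _ (hmem a ha i (m + 1) hbm))
      · obtain ⟨j, rfl⟩ : ∃ j, i = j + 1 := ⟨i - 1, by omega⟩
        rw [cprod_shift t N hcomm hbraid b m j (by omega) (by omega) (by omega), ← mul_assoc]
        exact hmem _ (hmul a ha j (by omega)) b m hbm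
    refine ⟨G, ?_, ?_, ?_⟩
    · calc G.card ≤ (F ×ˢ Finset.range (k + 2)).card := Finset.card_image_le
        _ = F.card * (k + 2) := by rw [Finset.card_product, Finset.card_range]
        _ ≤ (k + 1).factorial * (k + 2) := Nat.mul_le_mul_right _ hF
        _ = (k + 1 + 1).factorial := by rw [Nat.factorial_succ (k + 1), mul_comm]
    · simpa [cprod] using hmem 1 h1 (k + 1) 0 (by omega)
    · intro a ha i hi
      induction ha using Submodule.span_induction with
      | mem a ha =>
        rw [hG] at ha
        obtain ⟨⟨c, m⟩, hp, rfl⟩ := Finset.mem_image.1 (Finset.mem_coe.1 ha)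
        simp only [Finset.mem_product, Finset.mem_range] at hp
        exact hmem' c (Submodule.subset_span hp.1) _ _ (by omega) i hi
      | zero => simp
      | add a c _ _ ha hc => rw [add_mul]; exact add_mem ha hc
      | smul r a _ ha => rw [smul_mul_assoc]; exact Submodule.smul_mem _ _ ha

end Spanning

theorem hecke_spanning (n : ℕ) : ∃ F : Finset (Hecke n),
    F.card ≤ Fintype.card (Equiv.Perm (Fin n)) ∧ Submodule.span ℤ[X] (F : Set (Hecke n)) = ⊤ := by
  let t : ℕ → Hecke n := fun k => if h : k < n - 1 then gen ⟨k, h⟩ else 0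
  have ht : ∀ (k : ℕ) (h : k < n - 1), t k = gen ⟨k, h⟩ := fun k h => dif_pos h
  obtain ⟨F, hF, h1, hmul⟩ := exists_spanning (R := ℤ[X]) t (n - 1) Polynomial.X
    (fun i j hij hj => by
      rw [ht i (by omega), ht j hj]; exact gen_comm _ _ hij)
    (fun i hi => by
      rw [ht i (by omega), ht (i + 1) hi]; exact gen_braid _ _ rfl)
    (fun i hi => by
      rw [ht i hi]; exact gen_quad _) (n - 1) le_rfl
  refine ⟨F, ?_, ?_⟩
  · rw [Fintype.card_perm, Fintype.card_fin]
    cases n with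
    | zero => exact hF
    | succ n => exact hF
  · rw [eq_top_iff]
    have key : ∀ y : FreeAlgebra ℤ[X] (Fin (n - 1)),
        ∀ a ∈ Submodule.span ℤ[X] (F : Set (Hecke n)),
          a * heckeMk n y ∈ Submodule.span ℤ[X] (F : Set (Hecke n)) := by
      intro y
      induction y using FreeAlgebra.induction with
      | grade0 r =>
        intro a ha
        rw [AlgHom.commutes, ← Algebra.commutes, ← Algebra.smul_def]
        exact Submodule.smul_mem _ _ ha
      | grade1 i =>
        intro a ha
        have := hmul a ha i i.2
        rwa [ht i i.2] at this
      | mul y z hy hz =>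
        intro a ha
        rw [map_mul, ← mul_assoc]
        exact hz _ (hy _ ha)
      | add y z hy hz =>
        intro a ha
        rw [map_add, mul_add]
        exact add_mem (hy _ ha) (hz _ ha)
    intro z _
    obtain ⟨y, rfl⟩ := RingQuot.mkAlgHom_surjective ℤ[X] (Rel n) z
    have := key y 1 h1
    rwa [one_mul] at this

theorem orbitMap_surjective (n : ℕ) : Function.Surjective (orbitMap n) := by
  intro m
  refine ⟨Finsupp.linearCombination ℤ[X] (fun w => T w) m, ?_⟩
  have : orbitMap n ∘ₗ Finsupp.linearCombination ℤ[X] (fun w => T w) = LinearMap.id := by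
    apply freeMod_ext
    intro w
    simp only [LinearMap.comp_apply, e, Finsupp.linearCombination_single, one_smul,
      LinearMap.id_apply]
    exact orbitMap_T w
  exact LinearMap.congr_fun this m

theorem orbitMap_injective (n : ℕ) : Function.Injective (orbitMap n) := by
  obtain ⟨F, hF, hspan⟩ := hecke_spanning n
  obtain ⟨emb⟩ : Nonempty (F ↪ Equiv.Perm (Fin n)) :=
    Function.Embedding.nonempty_of_card_le (by simpa using hF)
  let p : (F →₀ ℤ[X]) →ₗ[ℤ[X]] Hecke n :=
    Finsupp.linearCombination ℤ[X] (fun x : F => (x : Hecke n))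
  have hp : Function.Surjective p := by
    rw [← LinearMap.range_eq_top, Finsupp.range_linearCombination]
    simpa using hspan
  let i : (F →₀ ℤ[X]) →ₗ[ℤ[X]] FreeMod n := Finsupp.lmapDomain ℤ[X] ℤ[X] emb
  have hi : Function.Injective i := Finsupp.mapDomain_injective emb.injective
  have hinj : Function.Injective (orbitMap n ∘ₗ p) :=
    OrzechProperty.injective_of_surjective_of_injective i (orbitMap n ∘ₗ p) hi
      ((orbitMap_surjective n).comp hp)
  intro a b hab
  obtain ⟨a, rfl⟩ := hp a
  obtain ⟨b, rfl⟩ := hp b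
  rw [hinj hab]

/-- The basis of the Hecke algebra consisting of the elements `T_w`, see `heckeBasis_apply`. -/
def heckeBasis (n : ℕ) : Module.Basis (Equiv.Perm (Fin n)) ℤ[X] (Hecke n) :=
  Module.Basis.ofRepr (LinearEquiv.ofBijective (orbitMap n)
    ⟨orbitMap_injective n, orbitMap_surjective n⟩)

theorem heckeBasis_apply {n : ℕ} (w : Equiv.Perm (Fin n)) : heckeBasis n w = T w := by
  apply orbitMap_injective n
  rw [orbitMap_T]
  exact (LinearEquiv.ofBijective (orbitMap n)
    ⟨orbitMap_injective n, orbitMap_surjective n⟩).apply_symm_apply (e w)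

theorem T_eq_of_isReducedWord {n : ℕ} {w : Equiv.Perm (Fin n)} {l : List (Fin (n - 1))}
    (h : IsReducedWord w l) : T w = wordGen l :=
  orbitMap_injective n (by rw [orbitMap_T, orbitMap_of_isReducedWord h])

/-! ### Parabolic subgroups and parabolic subalgebras -/

/-- The simple reflections generating the parabolic subgroup of a composition. The reflection with
index `j` counted from `0` is number `j + 1` in the usual numbering, and it belongs to the `i`-th
block when `j + 1` lies strictly between the sums of the parts before and up to that block. -/
def IsParabolicIndex {n : ℕ} (lam : Composition n) (j : Fin (n - 1)) : Prop :=
  ∃ i : Fin lam.length, lam.sizeUpTo i < (j : ℕ) + 1 ∧ (j : ℕ) + 1 < lam.sizeUpTo (i + 1)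

/-- The parabolic subgroup of a composition. -/
def parabolic {n : ℕ} (lam : Composition n) : Subgroup (Equiv.Perm (Fin n)) :=
  Subgroup.closure {w | ∃ j, IsParabolicIndex lam j ∧ w = simple j}

/-- The parabolic subalgebra of a composition. -/
def parabolicAlg {n : ℕ} (lam : Composition n) : Subalgebra ℤ[X] (Hecke n) :=
  Algebra.adjoin ℤ[X] {x | ∃ j, IsParabolicIndex lam j ∧ x = gen j}

theorem T_mem_parabolicAlg {n : ℕ} (lam : Composition n) (w : Equiv.Perm (Fin n))
    (hw : w ∈ parabolic lam) : T w ∈ parabolicAlg lam := by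
  have step : ∀ j, IsParabolicIndex lam j → ∀ v : Equiv.Perm (Fin n),
      T v ∈ parabolicAlg lam → T (simple j * v) ∈ parabolicAlg lam := by
    intro j hj v hv
    have h1 : T (simple j * v) = gen j * T v - xi (Desc j v) • T v := by
      apply orbitMap_injective n
      rw [map_sub, map_smul, orbitMap_gen_mul, orbitMap_T, orbitMap_T, lop_e, add_sub_cancel_right]
    rw [h1]
    exact sub_mem (mul_mem (Algebra.subset_adjoin ⟨j, hj, rfl⟩) hv) (Subalgebra.smul_mem _ hv _)
  have hone : T (1 : Equiv.Perm (Fin n)) ∈ parabolicAlg lam := by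
    have : T (1 : Equiv.Perm (Fin n)) = 1 := by
      apply orbitMap_injective n
      rw [orbitMap_T, orbitMap_one]
    rw [this]
    exact one_mem _
  unfold parabolic at hw
  induction hw using Subgroup.closure_induction_left with
  | one => exact hone
  | mul_left x hx y _ ih =>
    obtain ⟨j, hj, rfl⟩ := hx
    exact step j hj y ih
  | inv_mul_cancel x hx y _ ih =>
    obtain ⟨j, hj, rfl⟩ := hx
    rw [simple_inv]
    exact step j hj y ih

open Classical in
/-- The projection of the Hecke algebra onto a parabolic subalgebra: the linear map that fixes `T_w`
for `w` in the parabolic subgroup and sends all other `T_w` to `0`. -/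
def proj {n : ℕ} (lam : Composition n) : Hecke n →ₗ[ℤ[X]] parabolicAlg lam :=
  (heckeBasis n).constr ℤ[X] fun w =>
    if h : w ∈ parabolic lam then ⟨T w, T_mem_parabolicAlg lam w h⟩ else 0

theorem proj_T {n : ℕ} (lam : Composition n) (w : Equiv.Perm (Fin n))
    [Decidable (w ∈ parabolic lam)] :
    (proj lam (T w) : Hecke n) = if w ∈ parabolic lam then T w else 0 := by
  rw [proj, ← heckeBasis_apply, Module.Basis.constr_basis]
  by_cases h : w ∈ parabolic lam <;> simp [h, heckeBasis_apply]

/-! ### Norms -/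

open Classical in
/-- The distinguished right coset representatives of `J` in `K`: the elements `d` of `K` that have
minimal length in their coset `J d`. -/
def distinguished {n : ℕ} (K J : Subgroup (Equiv.Perm (Fin n))) : Finset (Equiv.Perm (Fin n)) :=
  Finset.univ.filter fun d => d ∈ K ∧ ∀ u ∈ J, len d ≤ len (u * d)

/-- The relative norm from `J` to `K` of an element of the Hecke algebra. -/
def relNorm {n : ℕ} (K J : Subgroup (Equiv.Perm (Fin n))) (h : Hecke n) : Hecke n :=
  ∑ d ∈ distinguished K J, T d⁻¹ * h * T d

/-- The composition obtained by replacing each part `k > 1` by the two parts `k - 1`, `1`. -/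
def subOne {n : ℕ} (lam : Composition n) : Composition n where
  blocks := lam.blocks.flatMap fun k => if 1 < k then [k - 1, 1] else [k]
  blocks_pos := by
    intro i hi
    obtain ⟨k, hk, hik⟩ := List.mem_flatMap.1 hi
    have := lam.blocks_pos hk
    split_ifs at hik
    · simp at hik
      omega
    · simp at hik
      omega
  blocks_sum := by
    have key : ∀ l : List ℕ,
        (l.flatMap fun k => if 1 < k then [k - 1, 1] else [k]).sum = l.sum := by
      intro l
      induction l with
      | nil => rfl
      | cons k l ih =>
        rw [List.flatMap_cons, List.sum_append, ih, List.sum_cons]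
        split_ifs
        · simp
          omega
        · simp
    rw [key, lam.blocks_sum]

open Classical in
/-- The Coxeter element of the parabolic subgroup of a composition: the product, in increasing
order, of the simple reflections generating the parabolic subgroup. -/
def coxeterElt {n : ℕ} (lam : Composition n) : Equiv.Perm (Fin n) :=
  wordProd ((List.finRange (n - 1)).filter fun j => IsParabolicIndex lam j)

/-- The Coxeter class element of the parabolic subalgebra of a composition. -/
def eta {n : ℕ} (lam : Composition n) : Hecke n :=
  relNorm (parabolic (subOne lam)) ⊥ (T (coxeterElt lam))

/-- The element `b_α` of the norm basis. -/
def normElt {n : ℕ} (α : Composition n) : Hecke n := relNorm ⊤ (parabolic α) (eta α)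

/-! ### Multipartitions and conjugacy classes -/

/-- A partition is a composition with weakly decreasing parts. -/
def IsPartition {n : ℕ} (c : Composition n) : Prop := c.blocks.Pairwise (· ≥ ·)

/-- The `λ`-multipartitions: families of partitions, one of each part of `λ`. -/
abbrev Multipartition {n : ℕ} (lam : Composition n) : Type :=
  ∀ i : Fin lam.length, {c : Composition (lam.blocksFun i) // IsPartition c}

/-- The composition derived from a multipartition by concatenating its partitions. -/
def derived {n : ℕ} {lam : Composition n} (θ : Multipartition lam) : Composition n where
  blocks := (List.ofFn fun i => (θ i).1.blocks).flatten
  blocks_pos := by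
    intro k hk
    obtain ⟨l, hl, hkl⟩ := List.mem_flatten.1 hk
    obtain ⟨i, rfl⟩ := (List.mem_ofFn' _ _).1 hl
    exact (θ i).1.blocks_pos hkl
  blocks_sum := by
    rw [List.sum_flatten, List.map_ofFn, List.sum_ofFn]
    simp only [Function.comp_apply, Composition.blocks_sum]
    exact lam.sum_blocksFun

open Classical in
/-- The `λ`-multipartitions of `α`: those whose parts, with multiplicities, are the parts of `α`. -/
def multipartitionsOf {n : ℕ} (lam α : Composition n) : Finset (Multipartition lam) :=
  Finset.univ.filter fun θ => ((derived θ).blocks : Multiset ℕ) = (α.blocks : Multiset ℕ)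

/-- The permutations of cycle type `α`, fixed points being counted as parts equal to `1`. -/
def cycleClass {n : ℕ} (α : Composition n) : Set (Equiv.Perm (Fin n)) :=
  {w | w.partition.parts = (α.blocks : Multiset ℕ)}

/-- The conjugacy class in the parabolic subgroup of `λ` that corresponds to the multipartition `θ`:
the class of the Coxeter element of the composition derived from `θ`. -/
def parabolicClass {n : ℕ} {lam : Composition n} (θ : Multipartition lam) :
    Set (Equiv.Perm (Fin n)) :=
  {w | ∃ g ∈ parabolic lam, w = g * coxeterElt (derived θ) * g⁻¹}

end SymHecke

end

/-!
The proof computes `π_λ(b_α)` term by term and needs neither the centrality of the norms nor the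
structure of the centre.

A parabolic subgroup consists of the permutations that preserve the blocks of its composition
(`mem_parabolic_iff`), and lengths add in the product of such a permutation and a distinguished
coset representative (`len_mul_of_incOn`). Hence for every subgroup `K` that contains `S_α` the
norm of `η_α` is a single sum of terms `T_{y⁻¹} T_{w_α} T_y`, over those `y` in `K` for which `y⁻¹`
attains its maximum on each block of `α` at the last letter of the block (`relNorm_eta`).

Write `y = g x` with `x` in `S_λ` and `g` increasing on the blocks of `λ`. As `π_λ` is linear over
`H_λ` on both sides, only `π_λ(T_{g⁻¹} T_{w_α} T_g)` matters. Colour each letter by the block of `λ`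
that contains its image under `g⁻¹`. If some block of `α` is not monochromatic, the projection
vanishes, because multiplication by the generators in `T_{w_α}` gives a letter a wrong
colour that is never corrected (`projEnd_eq_zero_of_not_monochromatic`). Otherwise it is
`T_{g⁻¹ w_α g}` (`projEnd_of_monochromatic`).

The remaining terms are indexed by the colourings of the blocks of `α` in which the `i`-th colour
is used on exactly `λ_i` letters. The blocks of colour `i`, in their order, form a partition of
`λ_i`, because the parts of `α` decrease; so a colouring gives a multipartition `θ`, and `g` carries
the blocks of `θ` to those of `α` and preserves the order in each (`Coloring.carriesBlocks`). So `g`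
conjugates `w_α` to `w_θ`, the terms with this colouring add up to the norm of `η_θ`, and `π_λ(b_α)`
is the sum of these norms over all colourings (`projEnd_normElt`).

It remains to count the colourings that give `θ`. An element conjugating `w_θ` to `w_α` is uniquely
a product `g y`, with `g` from such a colouring and `y` in the centralizer of `w_θ` in `S_λ`
(`card_conjugating_eq`). So the number of these colourings is the quotient of the orders of the
centralizers of `w_θ` in `S_n` and in `S_λ`, which is the coefficient in the theorem
(`card_coloring_mul`).
-/

namespace SymHecke

theorem apply_inv_apply {n : ℕ} (g : Equiv.Perm (Fin n)) (a : Fin n) : g (g⁻¹ a) = a := by simp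

theorem inv_apply_apply {n : ℕ} (g : Equiv.Perm (Fin n)) (a : Fin n) : g⁻¹ (g a) = a := by simp

/-! ### Blocks of a composition -/

/-- `p` is the sum of an initial segment of the parts of `c`: a new block of `c` begins at `p`,
or `p` is the end of the last block. -/
def IsCut {n : ℕ} (c : Composition n) (p : ℕ) : Prop := ∃ i, c.sizeUpTo i = p

/-- `b` is the last letter of its block. -/
def IsLast {n : ℕ} (c : Composition n) (b : Fin n) : Prop :=
  ∀ a, c.index a = c.index b → a ≤ b

/-- `w` is increasing on every block of `c`. -/
def IncOn {n : ℕ} (c : Composition n) (w : Equiv.Perm (Fin n)) : Prop :=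
  ∀ a b, c.index a = c.index b → a < b → w a < w b

theorem index_mono {n : ℕ} (c : Composition n) {a b : Fin n} (h : a ≤ b) :
    c.index a ≤ c.index b := by
  by_contra hlt
  have h1 := c.lt_sizeUpTo_index_succ b
  have h2 := c.sizeUpTo_index_le a
  have h3 : c.sizeUpTo (c.index b).succ ≤ c.sizeUpTo (c.index a) :=
    c.monotone_sizeUpTo (by rw [not_le, Fin.lt_def] at hlt; simpa using hlt)
  rw [Fin.le_def] at h
  omega

theorem index_eq_of_sizeUpTo {n : ℕ} (c : Composition n) (i : Fin c.length) (a : Fin n)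
    (h1 : c.sizeUpTo i ≤ a) (h2 : (a : ℕ) < c.sizeUpTo (i + 1)) : c.index a = i := by
  symm
  rw [← Composition.mem_range_embedding_iff']
  exact (c.mem_range_embedding_iff).2 ⟨h1, h2⟩

theorem index_eq_iff {n : ℕ} (c : Composition n) {a b : Fin n} (hab : a ≤ b) :
    c.index a = c.index b ↔ ∀ p, (a : ℕ) < p → p ≤ b → ¬ IsCut c p := by
  constructor
  · rintro h p hap hpb ⟨i, rfl⟩
    have h1 := c.lt_sizeUpTo_index_succ b
    have h2 := c.sizeUpTo_index_le a
    rcases le_or_gt i (c.index a) with h3 | h3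
    · have := c.monotone_sizeUpTo h3
      omega
    · rw [h] at h3
      have := c.monotone_sizeUpTo (Nat.succ_le_of_lt h3)
      simp only [Fin.val_succ, Nat.succ_eq_add_one] at h1 this
      omega
  · intro h
    by_contra hne
    have h1 := lt_of_le_of_ne (index_mono c hab) hne
    have h2 := c.lt_sizeUpTo_index_succ a
    refine h (c.sizeUpTo (c.index b)) (lt_of_lt_of_le h2 (c.monotone_sizeUpTo ?_))
      (c.sizeUpTo_index_le b) ⟨_, rfl⟩
    rw [Fin.lt_def] at h1
    simpa using h1

theorem lo_le_hi {n : ℕ} (j : Fin (n - 1)) : (lo j : Fin n) ≤ hi j := (lo_lt_hi j).le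

theorem isParabolicIndex_iff {n : ℕ} (c : Composition n) (j : Fin (n - 1)) :
    IsParabolicIndex c j ↔ c.index (lo j) = c.index (hi j) := by
  constructor
  · rintro ⟨i, h1, h2⟩
    rw [index_eq_of_sizeUpTo c i (lo j) (by simp only [lo]; omega) (by simp only [lo]; omega),
      index_eq_of_sizeUpTo c i (hi j) (by simp only [hi]; omega) (by simp only [hi]; omega)]
  · intro h
    refine ⟨c.index (lo j), ?_, ?_⟩
    · have := c.sizeUpTo_index_le (lo j)
      simp only [lo] at this ⊢
      omega
    · rw [h]
      exact c.lt_sizeUpTo_index_succ (hi j)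

theorem isLast_iff {n : ℕ} (c : Composition n) (b : Fin n) : IsLast c b ↔ IsCut c (b + 1) := by
  constructor
  · intro h
    refine ⟨(c.index b).succ, ?_⟩
    have h1 := c.lt_sizeUpTo_index_succ b
    by_contra hne
    have h2 : (b : ℕ) + 1 < c.sizeUpTo (c.index b).succ := by omega
    have h3 := h ⟨b + 1, h2.trans_le (c.sizeUpTo_le _)⟩
      (index_eq_of_sizeUpTo c _ _ (by have := c.sizeUpTo_index_le b; simp only; omega) h2)
    rw [Fin.le_def] at h3
    simp at h3
  · intro h a ha
    by_contra hlt
    rw [not_le] at hlt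
    rw [Fin.lt_def] at hlt
    exact (index_eq_iff c (a := b) (b := a) (by rw [Fin.le_def]; omega)).1 ha.symm (b + 1)
      (by omega) (by omega) h

theorem index_mid {n : ℕ} (c : Composition n) {a m b : Fin n} (h : c.index a = c.index b)
    (h1 : a ≤ m) (h2 : m ≤ b) : c.index m = c.index a :=
  le_antisymm (h ▸ index_mono c h2) (index_mono c h1)

theorem exists_isLast {n : ℕ} (c : Composition n) (a : Fin n) :
    ∃ b, c.index b = c.index a ∧ IsLast c b := by
  classical
  obtain ⟨b, hb, hmax⟩ := (Finset.univ.filter fun b => c.index b = c.index a).exists_max_image id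
    ⟨a, by simp⟩
  simp only [Finset.mem_filter, Finset.mem_univ, true_and, id] at hb hmax
  exact ⟨b, hb, fun x hx => hmax x (hx.trans hb)⟩

/-- Adjacent letters suffice to prove a transitive relation between letters of a block. -/
theorem block_induction {n : ℕ} (c : Composition n) {r : Fin n → Fin n → Prop}
    (htrans : ∀ x y z, r x y → r y z → r x z)
    (h : ∀ j : Fin (n - 1), IsParabolicIndex c j → r (lo j) (hi j)) {a b : Fin n} (hab : a < b)
    (hc : c.index a = c.index b) : r a b := by
  obtain ⟨b, hb⟩ := b
  induction b with
  | zero => simp [Fin.lt_def] at hab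
  | succ b ih =>
    have hb' : b < n := by omega
    have hle : a ≤ ⟨b, hb'⟩ := by
      rw [Fin.lt_def] at hab
      rw [Fin.le_def]
      simp only at hab ⊢
      omega
    have hmid := index_mid c hc hle (by simp [Fin.le_def])
    have hstep : r ⟨b, hb'⟩ ⟨b + 1, hb⟩ :=
      h ⟨b, by omega⟩ ((isParabolicIndex_iff c _).2 (hmid.trans hc))
    rcases hle.eq_or_lt with heq | hlt
    · rw [heq]; exact hstep
    · exact htrans _ _ _ (ih hb' hlt hmid.symm) hstep

theorem incOn_iff {n : ℕ} (c : Composition n) (d : Equiv.Perm (Fin n)) :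
    IncOn c d⁻¹ ↔ ∀ j, IsParabolicIndex c j → ¬ Desc j d := by
  constructor
  · intro h j hj
    exact (h _ _ ((isParabolicIndex_iff c j).1 hj) (lo_lt_hi j)).not_gt
  · intro h a b hc hab
    refine block_induction c (r := fun a b => d⁻¹ a < d⁻¹ b) (fun x y z => lt_trans) ?_ hab hc
    intro j hj
    refine lt_of_le_of_ne (not_lt.1 (h j hj)) fun he => ?_
    exact (lo_lt_hi j).ne (d⁻¹.injective he)

/-! ### Parabolic subgroups and coset representatives -/

theorem desc_of_preserves {n : ℕ} (c : Composition n) (w : Equiv.Perm (Fin n))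
    (h : ∀ a, c.index (w a) = c.index a) (j : Fin (n - 1)) (hj : Desc j w) :
    IsParabolicIndex c j := by
  rw [isParabolicIndex_iff]
  have h1 : ∀ a, c.index (w⁻¹ a) = c.index a := fun a => by rw [← h]; simp
  refine le_antisymm (index_mono c (lo_le_hi j)) ?_
  rw [← h1, ← h1 (lo j)]
  exact index_mono c (le_of_lt hj)

theorem simple_mem_parabolic {n : ℕ} {c : Composition n} {j : Fin (n - 1)}
    (hj : IsParabolicIndex c j) : simple j ∈ parabolic c :=
  Subgroup.subset_closure ⟨j, hj, rfl⟩

theorem index_simple {n : ℕ} {c : Composition n} {j : Fin (n - 1)}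
    (hj : IsParabolicIndex c j) (a : Fin n) : c.index (simple j a) = c.index a := by
  rw [isParabolicIndex_iff] at hj
  by_cases h1 : a = lo j
  · rw [h1, simple_lo, hj]
  by_cases h2 : a = hi j
  · rw [h2, simple_hi, hj]
  rw [simple, Equiv.swap_apply_of_ne_of_ne h1 h2]

/-- The parabolic subgroup of a composition consists of the permutations that preserve the
blocks. -/
theorem mem_parabolic_iff {n : ℕ} (c : Composition n) (w : Equiv.Perm (Fin n)) :
    w ∈ parabolic c ↔ ∀ a, c.index (w a) = c.index a := by
  constructor
  · intro hw
    induction hw using Subgroup.closure_induction with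
    | mem x hx =>
      obtain ⟨j, hj, rfl⟩ := hx
      exact index_simple hj
    | one => intro a; rfl
    | mul x y _ _ hx hy => intro a; rw [Equiv.Perm.mul_apply, hx, hy]
    | inv x _ hx => intro a; rw [← hx]; simp
  · intro h
    induction hk : invCount w using Nat.strong_induction_on generalizing w with
    | _ k ih =>
      by_cases h1 : ∀ i, ¬ Desc i w
      · rw [eq_one_of_no_desc w h1]
        exact one_mem _
      · push Not at h1
        obtain ⟨j, hj⟩ := h1
        have h2 := invCount_of_desc j w hj
        have h3 := desc_of_preserves c w h j hj
        have h4 := ih _ (by omega) (simple j * w)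
          (fun a => by rw [Equiv.Perm.mul_apply, index_simple h3, h]) rfl
        rw [← simple_mul_cancel j w]
        exact mul_mem (simple_mem_parabolic h3) h4

theorem index_inv {n : ℕ} {c : Composition n} {w : Equiv.Perm (Fin n)} (hw : w ∈ parabolic c)
    (a : Fin n) : c.index (w⁻¹ a) = c.index a :=
  (mem_parabolic_iff c _).1 (inv_mem hw) a

theorem len_inv {n : ℕ} (w : Equiv.Perm (Fin n)) : len w⁻¹ = len w := by
  have key : ∀ w : Equiv.Perm (Fin n), len w⁻¹ ≤ len w := by
    intro w
    obtain ⟨l, h1, h2⟩ := exists_reducedWord w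
    rw [← h2, len_eq_invCount, ← List.length_reverse, ← h1]
    have : (wordProd l)⁻¹ = wordProd l.reverse := by
      rw [wordProd, List.prod_inv_reverse, wordProd, List.map_map, List.map_reverse]
      congr 2
    rw [this]
    exact invCount_wordProd_le _
  exact le_antisymm (key w) (by simpa using key w⁻¹)

theorem len_simple_mul {n : ℕ} {j : Fin (n - 1)} {w : Equiv.Perm (Fin n)} (h : ¬ Desc j w) :
    len (simple j * w) = len w + 1 := by
  rw [len_eq_invCount, len_eq_invCount, invCount_simple_mul j w h]

theorem len_of_desc {n : ℕ} {j : Fin (n - 1)} {w : Equiv.Perm (Fin n)} (h : Desc j w) :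
    len w = len (simple j * w) + 1 := by
  rw [len_eq_invCount, len_eq_invCount, invCount_of_desc j w h]

/-- Lengths add in a product of an element of a parabolic subgroup and an element whose inverse is
increasing on the blocks. -/
theorem len_mul_of_incOn {n : ℕ} {c : Composition n} {u d : Equiv.Perm (Fin n)}
    (hu : u ∈ parabolic c) (hd : IncOn c d⁻¹) : len (u * d) = len u + len d := by
  induction hk : len u using Nat.strong_induction_on generalizing u with
  | _ k ih =>
    by_cases h1 : ∀ i, ¬ Desc i u
    · have := eq_one_of_no_desc u h1
      subst this
      rw [len_eq_invCount, invCount_one] at hk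
      rw [← hk, one_mul, zero_add]
    · push Not at h1
      obtain ⟨j, hj⟩ := h1
      have h2 := len_of_desc hj
      have h3 := desc_of_preserves c u ((mem_parabolic_iff c u).1 hu) j hj
      have h4 := ih _ (by omega) (mul_mem (simple_mem_parabolic h3) hu) rfl
      have h5 : Desc j (u * d) := by
        simp only [Desc, mul_inv_rev, Equiv.Perm.mul_apply]
        refine hd _ _ ?_ hj
        rw [index_inv hu, index_inv hu, (isParabolicIndex_iff c j).1 h3]
      rw [len_of_desc h5, ← mul_assoc, h4]
      omega

theorem mem_distinguished_parabolic {n : ℕ} (K : Subgroup (Equiv.Perm (Fin n)))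
    (c : Composition n) (d : Equiv.Perm (Fin n)) :
    d ∈ distinguished K (parabolic c) ↔ d ∈ K ∧ IncOn c d⁻¹ := by
  simp only [distinguished, Finset.mem_filter, Finset.mem_univ, true_and]
  refine and_congr_right fun _ => ⟨fun h => ?_, fun h u hu => ?_⟩
  · rw [incOn_iff]
    intro j hj hdesc
    have h1 := h _ (simple_mem_parabolic hj)
    have h2 := len_of_desc hdesc
    omega
  · rw [len_mul_of_incOn hu h]
    omega

theorem mem_distinguished_bot {n : ℕ} (K : Subgroup (Equiv.Perm (Fin n)))
    (d : Equiv.Perm (Fin n)) : d ∈ distinguished K ⊥ ↔ d ∈ K := by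
  simp [distinguished]

theorem exists_factorization {n : ℕ} (c : Composition n) (y : Equiv.Perm (Fin n)) :
    ∃ u ∈ parabolic c, ∃ d, IncOn c d⁻¹ ∧ y = u * d := by
  classical
  obtain ⟨u, hu, hmin⟩ := (Finset.univ.filter fun u => u ∈ parabolic c).exists_min_image
    (fun u => len (u * y)) ⟨1, by simp [one_mem]⟩
  simp only [Finset.mem_filter, Finset.mem_univ, true_and] at hu hmin
  refine ⟨u⁻¹, inv_mem hu, u * y, ?_, by simp⟩
  refine ((mem_distinguished_parabolic ⊤ c (u * y)).1 ?_).2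
  simp only [distinguished, Finset.mem_filter, Finset.mem_univ, true_and, Subgroup.mem_top]
  intro v hv
  rw [← mul_assoc]
  exact hmin _ (mul_mem hv hu)

theorem factorization_unique {n : ℕ} {c : Composition n} {u u' d d' : Equiv.Perm (Fin n)}
    (hu : u ∈ parabolic c) (hu' : u' ∈ parabolic c) (hd : IncOn c d⁻¹) (hd' : IncOn c d'⁻¹)
    (h : u * d = u' * d') : u = u' ∧ d = d' := by
  have hv : u'⁻¹ * u ∈ parabolic c := mul_mem (inv_mem hu') hu
  have h1 : u'⁻¹ * u = 1 := by
    apply eq_one_of_no_desc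
    intro j hj
    have h2 := desc_of_preserves c _ ((mem_parabolic_iff c _).1 hv) j hj
    have h3 : d' = u'⁻¹ * u * d := by rw [mul_assoc, h]; simp
    have h4 := (isParabolicIndex_iff c j).1 h2
    have h5 := hd' _ _ h4 (lo_lt_hi j)
    rw [h3, mul_inv_rev, Equiv.Perm.mul_apply, Equiv.Perm.mul_apply] at h5
    have h6 := hd _ _ (by rw [index_inv hv, index_inv hv, h4]) hj
    exact h5.not_gt h6
  have h2 : u = u' := by rw [← mul_one u', ← h1]; simp
  subst h2
  exact ⟨rfl, mul_left_cancel h⟩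

theorem parabolic_le_of_index {n : ℕ} {c c' : Composition n}
    (h : ∀ a b, c.index a = c.index b → c'.index a = c'.index b) : parabolic c ≤ parabolic c' := by
  intro w hw
  rw [mem_parabolic_iff] at hw ⊢
  exact fun a => h _ _ (hw a)

/-! ### Partial sums of lists -/

/-- The sums of the initial segments of a list. -/
def IsPartialSum (l : List ℕ) (p : ℕ) : Prop := ∃ i, (l.take i).sum = p

theorem isCut_iff {n : ℕ} (c : Composition n) (p : ℕ) : IsCut c p ↔ IsPartialSum c.blocks p :=
  Iff.rfl

theorem isPartialSum_nil (p : ℕ) : IsPartialSum [] p ↔ p = 0 := by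
  simp [IsPartialSum, eq_comm]

theorem isPartialSum_zero (l : List ℕ) : IsPartialSum l 0 := ⟨0, by simp⟩

theorem isPartialSum_cons (k : ℕ) (l : List ℕ) (p : ℕ) :
    IsPartialSum (k :: l) p ↔ p = 0 ∨ ∃ q, IsPartialSum l q ∧ p = k + q := by
  constructor
  · rintro ⟨i, rfl⟩
    cases i with
    | zero => exact Or.inl (by simp)
    | succ i => exact Or.inr ⟨_, ⟨i, rfl⟩, by simp⟩
  · rintro (rfl | ⟨q, ⟨i, rfl⟩, rfl⟩)
    · exact isPartialSum_zero _
    · exact ⟨i + 1, by simp⟩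

theorem isPartialSum_sum (l : List ℕ) : IsPartialSum l l.sum := ⟨l.length, by simp⟩

theorem isPartialSum_append (l l' : List ℕ) (p : ℕ) :
    IsPartialSum (l ++ l') p ↔ IsPartialSum l p ∨ ∃ q, IsPartialSum l' q ∧ p = l.sum + q := by
  induction l generalizing p with
  | nil =>
    simp only [List.nil_append, isPartialSum_nil, List.sum_nil, zero_add, exists_eq_right']
    exact ⟨Or.inr, fun h => h.elim (fun h => h ▸ isPartialSum_zero _) id⟩
  | cons k l ih =>
    simp only [List.cons_append, isPartialSum_cons, ih, List.sum_cons]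
    constructor
    · rintro (h | ⟨q, h | ⟨r, hr, rfl⟩, rfl⟩)
      · exact Or.inl (Or.inl h)
      · exact Or.inl (Or.inr ⟨q, h, rfl⟩)
      · exact Or.inr ⟨r, hr, by omega⟩
    · rintro ((h | ⟨q, h, rfl⟩) | ⟨r, hr, rfl⟩)
      · exact Or.inl h
      · exact Or.inr ⟨q, Or.inl h, rfl⟩
      · exact Or.inr ⟨_, Or.inr ⟨r, hr, rfl⟩, by omega⟩

theorem isPartialSum_flatten (L : List (List ℕ)) (p : ℕ) :
    IsPartialSum L.flatten p ↔
      p = 0 ∨ ∃ (i : ℕ) (h : i < L.length) (q : ℕ), IsPartialSum L[i] q ∧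
        p = ((L.take i).map List.sum).sum + q := by
  induction L generalizing p with
  | nil => simp [isPartialSum_nil]
  | cons l L ih =>
    rw [List.flatten_cons, isPartialSum_append]
    constructor
    · rintro (h | ⟨q, hq, rfl⟩)
      · exact Or.inr ⟨0, by simp, p, by simpa using h, by simp⟩
      · rcases (ih q).1 hq with rfl | ⟨i, h, r, hr, rfl⟩
        · exact Or.inr ⟨0, by simp, l.sum, by simpa using isPartialSum_sum l, by simp⟩
        · exact Or.inr ⟨i + 1, by simpa using h, r, by simpa using hr, by simp [add_assoc]⟩
    · rintro (rfl | ⟨i, h, q, hq, rfl⟩)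
      · exact Or.inl (isPartialSum_zero _)
      · cases i with
        | zero => exact Or.inl (by simpa using hq)
        | succ i =>
          refine Or.inr ⟨((L.take i).map List.sum).sum + q, (ih _).2 (Or.inr ⟨i, ?_, q, ?_, rfl⟩), ?_⟩
          · simpa using h
          · simpa using hq
          · simp [add_assoc]

theorem isPartialSum_filter_map {ι : Type*} (l : List ι) (P : ι → Bool) (h : ι → ℕ) (p : ℕ) :
    IsPartialSum ((l.filter P).map h) p ↔ ∃ k ≤ l.length, (((l.take k).filter P).map h).sum = p := by
  induction l generalizing p with
  | nil => simp [isPartialSum_nil, eq_comm]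
  | cons a l ih =>
    have key : (∃ k ≤ (a :: l).length, ((((a :: l).take k).filter P).map h).sum = p) ↔
        p = 0 ∨ ∃ k ≤ l.length, (((a :: l.take k).filter P).map h).sum = p := by
      constructor
      · rintro ⟨k, hk, rfl⟩
        cases k with
        | zero => exact Or.inl (by simp)
        | succ k => exact Or.inr ⟨k, by simpa using hk, by simp⟩
      · rintro (rfl | ⟨k, hk, rfl⟩)
        · exact ⟨0, by simp, by simp⟩
        · exact ⟨k + 1, by simpa using hk, by simp⟩
    rw [key]
    by_cases ha : P a
    · rw [List.filter_cons_of_pos ha, List.map_cons, isPartialSum_cons]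
      refine or_congr_right ⟨?_, ?_⟩
      · rintro ⟨q, hq, rfl⟩
        obtain ⟨k, hk, rfl⟩ := (ih q).1 hq
        exact ⟨k, hk, by rw [List.filter_cons_of_pos ha, List.map_cons, List.sum_cons]⟩
      · rintro ⟨k, hk, rfl⟩
        exact ⟨_, (ih _).2 ⟨k, hk, rfl⟩,
          by rw [List.filter_cons_of_pos ha, List.map_cons, List.sum_cons]⟩
    · rw [List.filter_cons_of_neg ha, ih]
      simp only [List.filter_cons_of_neg ha]
      constructor
      · exact Or.inr
      · rintro (rfl | h)
        · exact ⟨0, by simp, by simp⟩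
        · exact h

/-! ### The composition with the last letter of each block split off -/

theorem isCut_subOne {n : ℕ} (c : Composition n) (p : ℕ) :
    IsCut (subOne c) p ↔ IsCut c p ∨ IsCut c (p + 1) := by
  have key : ∀ l : List ℕ, (∀ k ∈ l, 0 < k) → ∀ p,
      IsPartialSum (l.flatMap fun k => if 1 < k then [k - 1, 1] else [k]) p ↔
        IsPartialSum l p ∨ IsPartialSum l (p + 1) := by
    intro l
    induction l with
    | nil => intro _ p; simp [isPartialSum_nil]
    | cons k l ih =>
      intro hl p
      have hk := hl k (by simp)
      have ih := ih fun k hk => hl k (by simp [hk])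
      rw [List.flatMap_cons, isPartialSum_append]
      simp only [ih, isPartialSum_cons]
      have hz := isPartialSum_zero l
      have h1 : (∃ q, IsPartialSum l q ∧ p + 1 = k + q) ↔
          p = k - 1 ∨ ∃ q, IsPartialSum l (q + 1) ∧ p = k + q := by
        constructor
        · rintro ⟨q, hq, h⟩
          cases q with
          | zero => exact Or.inl (by omega)
          | succ q => exact Or.inr ⟨q, hq, by omega⟩
        · rintro (h | ⟨q, hq, h⟩)
          · exact ⟨0, hz, by omega⟩
          · exact ⟨q + 1, hq, by omega⟩
      rw [h1]
      have hsum : ((if 1 < k then [k - 1, 1] else [k] : List ℕ)).sum = k := by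
        split_ifs
        · simp; omega
        · simp
      rw [hsum]
      have h2 : IsPartialSum (if 1 < k then [k - 1, 1] else [k]) p ↔ p = 0 ∨ p = k - 1 ∨ p = k := by
        split_ifs
        · simp only [isPartialSum_cons, isPartialSum_nil]
          constructor
          · rintro (h | ⟨q, rfl | ⟨r, rfl, rfl⟩, rfl⟩) <;> omega
          · rintro (h | h | h)
            · exact Or.inl h
            · exact Or.inr ⟨0, Or.inl rfl, by omega⟩
            · exact Or.inr ⟨1, Or.inr ⟨0, rfl, rfl⟩, by omega⟩
        · simp only [isPartialSum_cons, isPartialSum_nil]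
          constructor
          · rintro (h | ⟨q, rfl, rfl⟩) <;> omega
          · rintro (h | h | h)
            · exact Or.inl h
            · exact Or.inl (by omega)
            · exact Or.inr ⟨0, rfl, by omega⟩
      rw [h2]
      constructor
      · rintro ((h | h | h) | ⟨q, h | h, hq⟩)
        · exact Or.inl (Or.inl h)
        · exact Or.inr (Or.inr (Or.inl h))
        · exact Or.inl (Or.inr ⟨0, hz, by omega⟩)
        · exact Or.inl (Or.inr ⟨q, h, hq⟩)
        · exact Or.inr (Or.inr (Or.inr ⟨q, h, hq⟩))
      · rintro ((h | ⟨q, h, hq⟩) | (h | h | ⟨q, h, hq⟩))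
        · exact Or.inl (Or.inl h)
        · exact Or.inr ⟨q, Or.inl h, hq⟩
        · omega
        · exact Or.inl (Or.inr (Or.inl h))
        · exact Or.inr ⟨q, Or.inr h, hq⟩
  exact key c.blocks (fun k hk => c.blocks_pos hk) p

theorem index_subOne_of_lt {n : ℕ} (c : Composition n) {a b : Fin n} (hab : a < b) :
    (subOne c).index a = (subOne c).index b ↔ c.index a = c.index b ∧ ¬ IsLast c b := by
  rw [index_eq_iff _ hab.le, index_eq_iff _ hab.le, isLast_iff]
  simp only [isCut_subOne, not_or]
  rw [Fin.lt_def] at hab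
  constructor
  · intro h
    exact ⟨fun p h1 h2 => (h p h1 h2).1, (h b hab le_rfl).2⟩
  · rintro ⟨h1, h2⟩ p h3 h4
    refine ⟨h1 p h3 h4, ?_⟩
    rcases h4.eq_or_lt with rfl | h4
    · exact h2
    · exact h1 (p + 1) (by omega) h4

theorem mem_parabolic_subOne_iff {n : ℕ} (c : Composition n) (w : Equiv.Perm (Fin n)) :
    w ∈ parabolic (subOne c) ↔ w ∈ parabolic c ∧ ∀ b, IsLast c b → w b = b := by
  rw [mem_parabolic_iff, mem_parabolic_iff]
  constructor
  · intro h
    refine ⟨fun a => ?_, fun b hb => ?_⟩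
    · rcases lt_trichotomy (w a) a with h1 | h1 | h1
      · exact ((index_subOne_of_lt c h1).1 (h a)).1
      · rw [h1]
      · exact ((index_subOne_of_lt c h1).1 (h a).symm).1.symm
    · rcases lt_trichotomy (w b) b with h1 | h1 | h1
      · exact absurd hb ((index_subOne_of_lt c h1).1 (h b)).2
      · exact h1
      · exact absurd (hb _ ((index_subOne_of_lt c h1).1 (h b).symm).1.symm) h1.not_ge
  · rintro ⟨h1, h2⟩ a
    have h3 : ¬ IsLast c a → ¬ IsLast c (w a) := fun h h' => by
      have := w.injective (h2 _ h')
      rw [this] at h'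
      exact h h'
    rcases lt_trichotomy (w a) a with h4 | h4 | h4
    · exact (index_subOne_of_lt c h4).2 ⟨h1 a, fun h => h4.ne (h2 a h)⟩
    · rw [h4]
    · exact ((index_subOne_of_lt c h4).2 ⟨(h1 a).symm, h3 fun h => h4.ne' (h2 a h)⟩).symm

/-! ### Coxeter elements -/

theorem wordProd_apply_of_lt {n : ℕ} (l : List (Fin (n - 1))) (a : Fin n)
    (h : ∀ i ∈ l, (a : ℕ) < (i : ℕ)) : wordProd l a = a := by
  induction l with
  | nil => rfl
  | cons i l ih =>
    rw [wordProd_cons, Equiv.Perm.mul_apply, ih fun i hi => h i (by simp [hi])]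
    have := h i (by simp)
    exact Fin.ext (by rw [simple_val]; split_ifs <;> omega)

theorem wordProd_apply_of_gt {n : ℕ} (l : List (Fin (n - 1))) (a : Fin n)
    (h : ∀ i ∈ l, (i : ℕ) + 1 < (a : ℕ)) : wordProd l a = a := by
  induction l with
  | nil => rfl
  | cons i l ih =>
    rw [wordProd_cons, Equiv.Perm.mul_apply, ih fun i hi => h i (by simp [hi])]
    have := h i (by simp)
    exact Fin.ext (by rw [simple_val]; split_ifs <;> omega)

theorem exists_sorted_split {m : ℕ} (l : List (Fin m)) (hl : l.Pairwise (· < ·)) {j : Fin m}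
    (hj : j ∈ l) : ∃ l₁ l₂, l = l₁ ++ j :: l₂ ∧ (∀ i ∈ l₁, i < j) ∧ ∀ i ∈ l₂, j < i := by
  obtain ⟨l₁, l₂, rfl⟩ := List.append_of_mem hj
  rw [List.pairwise_append, List.pairwise_cons] at hl
  exact ⟨l₁, l₂, rfl, fun i hi => hl.2.2 i hi j (by simp), hl.2.1.1⟩

theorem wordProd_append {n : ℕ} (l l' : List (Fin (n - 1))) :
    wordProd (l ++ l') = wordProd l * wordProd l' := by simp [wordProd]

theorem wordProd_apply_lo {n : ℕ} (l : List (Fin (n - 1))) (hl : l.Pairwise (· < ·))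
    {j : Fin (n - 1)} (hj : j ∈ l) : wordProd l (lo j) = hi j := by
  obtain ⟨l₁, l₂, rfl, h1, h2⟩ := exists_sorted_split l hl hj
  rw [wordProd_append, wordProd_cons, Equiv.Perm.mul_apply, Equiv.Perm.mul_apply,
    wordProd_apply_of_lt l₂, simple_lo, wordProd_apply_of_gt l₁]
  · intro i hi'
    have := h1 i hi'
    rw [Fin.lt_def] at this
    simp only [hi]
    omega
  · intro i hi'
    exact h2 i hi'

open Classical in
/-- The simple reflections of a parabolic subgroup in increasing order. -/
noncomputable def parabolicWord {n : ℕ} (c : Composition n) : List (Fin (n - 1)) :=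
  (List.finRange (n - 1)).filter fun j => IsParabolicIndex c j

theorem coxeterElt_eq {n : ℕ} (c : Composition n) : coxeterElt c = wordProd (parabolicWord c) := rfl

theorem mem_parabolicWord {n : ℕ} {c : Composition n} {j : Fin (n - 1)} :
    j ∈ parabolicWord c ↔ IsParabolicIndex c j := by
  simp [parabolicWord]

theorem parabolicWord_sorted {n : ℕ} (c : Composition n) : (parabolicWord c).Pairwise (· < ·) :=
  (List.pairwise_lt_finRange _).filter _

theorem coxeterElt_mem {n : ℕ} (c : Composition n) : coxeterElt c ∈ parabolic c := by
  rw [coxeterElt_eq, wordProd]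
  refine list_prod_mem fun x hx => ?_
  obtain ⟨j, hj, rfl⟩ := List.mem_map.1 hx
  exact simple_mem_parabolic (mem_parabolicWord.1 hj)

theorem index_coxeterElt {n : ℕ} (c : Composition n) (a : Fin n) :
    c.index (coxeterElt c a) = c.index a :=
  (mem_parabolic_iff c _).1 (coxeterElt_mem c) a

theorem coxeterElt_lo {n : ℕ} {c : Composition n} {j : Fin (n - 1)} (hj : IsParabolicIndex c j) :
    coxeterElt c (lo j) = hi j :=
  wordProd_apply_lo _ (parabolicWord_sorted c) (mem_parabolicWord.2 hj)

/-- The simple reflection moving a letter that is not the last one of its block, and the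
next letter. -/
theorem exists_lo_of_not_isLast {n : ℕ} (c : Composition n) (a : Fin n) (h : ¬ IsLast c a) :
    ∃ j, IsParabolicIndex c j ∧ lo j = a := by
  simp only [IsLast, not_forall, not_le] at h
  obtain ⟨b, hb, hab⟩ := h
  rw [Fin.lt_def] at hab
  refine ⟨⟨a, by omega⟩, (isParabolicIndex_iff c _).2 ?_, rfl⟩
  change c.index a = _
  exact (index_mid c hb.symm (by simp only [hi, Fin.le_def]; omega)
    (by simp only [hi, Fin.le_def]; omega)).symm

/-- A Coxeter element sends the last letter of a block to the first one. -/
theorem coxeterElt_of_isLast {n : ℕ} (c : Composition n) {a b : Fin n} (ha : IsLast c a)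
    (hb : c.index b = c.index a) : coxeterElt c a ≤ b := by
  classical
  by_contra hlt
  rw [not_le] at hlt
  -- The letter preceding the image of `a` has the same image as `a`, so it is `a`, and `a` is
  -- not the last letter.
  have h1 : c.index b = c.index (coxeterElt c a) := by rw [index_coxeterElt, hb]
  rw [Fin.lt_def] at hlt
  obtain ⟨j, hj⟩ : ∃ j : Fin (n - 1), hi j = coxeterElt c a :=
    ⟨⟨(coxeterElt c a : ℕ) - 1, by omega⟩, Fin.ext (by simp only [hi]; omega)⟩
  have h2 : c.index (lo j) = c.index b := by
    refine index_mid c h1 ?_ (hj ▸ lo_le_hi j)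
    have := congrArg Fin.val hj
    simp only [lo, hi, Fin.le_def] at this ⊢
    omega
  have h3 : IsParabolicIndex c j := by rw [isParabolicIndex_iff, h2, h1, hj]
  have h4 : lo j = a := (coxeterElt c).injective (by rw [coxeterElt_lo h3, hj])
  have h5 := ha (hi j) (by rw [hj, index_coxeterElt])
  exact (lo_lt_hi j).not_ge (h4 ▸ h5)

/-- The cycles of a Coxeter element are the blocks. -/
theorem sameCycle_coxeterElt {n : ℕ} (c : Composition n) (a b : Fin n) :
    (coxeterElt c).SameCycle a b ↔ c.index a = c.index b := by
  constructor
  · rintro ⟨k, rfl⟩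
    exact ((mem_parabolic_iff c _).1 (zpow_mem (coxeterElt_mem c) k) a).symm
  · have key : ∀ a b, a < b → c.index a = c.index b → (coxeterElt c).SameCycle a b := by
      intro a b hab hc
      refine block_induction c (fun x y z => Equiv.Perm.SameCycle.trans) ?_ hab hc
      intro j hj
      exact ⟨1, by rw [zpow_one, coxeterElt_lo hj]⟩
    intro h
    rcases lt_trichotomy a b with h1 | rfl | h1
    · exact key a b h1 h
    · exact Equiv.Perm.SameCycle.refl _ _
    · exact (key b a h1 h.symm).symm

/-- `g` carries the blocks of `d` to the blocks of `c`, preserving the order within each block. -/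
structure CarriesBlocks {n : ℕ} (g : Equiv.Perm (Fin n)) (d c : Composition n) : Prop where
  index_iff : ∀ a b, d.index a = d.index b ↔ c.index (g a) = c.index (g b)
  incOn : IncOn d g

theorem CarriesBlocks.le_iff {n : ℕ} {c d : Composition n} {g : Equiv.Perm (Fin n)}
    (hg : CarriesBlocks g d c) {a b : Fin n} (h : d.index a = d.index b) : a ≤ b ↔ g a ≤ g b := by
  constructor
  · intro h1
    rcases h1.eq_or_lt with rfl | h1
    · exact le_rfl
    · exact (hg.incOn _ _ h h1).le
  · intro h1
    by_contra h2
    exact (hg.incOn _ _ h.symm (not_le.1 h2)).not_ge h1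

theorem CarriesBlocks.isLast_iff {n : ℕ} {c d : Composition n} {g : Equiv.Perm (Fin n)}
    (hg : CarriesBlocks g d c) (a : Fin n) : IsLast c (g a) ↔ IsLast d a := by
  constructor
  · intro h b hb
    exact (hg.le_iff hb).2 (h _ ((hg.index_iff _ _).1 hb))
  · intro h b hb
    have h1 : d.index (g⁻¹ b) = d.index a := by rw [hg.index_iff, apply_inv_apply, hb]
    have := (hg.le_iff h1).1 (h _ h1)
    rwa [apply_inv_apply] at this

/-- A permutation that carries the blocks of `d` to those of `c` conjugates the Coxeter element of
`d` to that of `c`. -/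
theorem CarriesBlocks.coxeterElt_conj {n : ℕ} {c d : Composition n} {g : Equiv.Perm (Fin n)}
    (hg : CarriesBlocks g d c) : g⁻¹ * coxeterElt c * g = coxeterElt d := by
  suffices h : coxeterElt c * g = g * coxeterElt d by rw [mul_assoc, h]; simp
  ext1 a
  rw [Equiv.Perm.mul_apply, Equiv.Perm.mul_apply]
  have hidx : c.index (coxeterElt c (g a)) = c.index (g a) := index_coxeterElt c _
  have hidx' : d.index (coxeterElt d a) = d.index a := index_coxeterElt d _
  have hpre : d.index (g⁻¹ (coxeterElt c (g a))) = d.index a := by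
    rw [hg.index_iff, apply_inv_apply, hidx]
  by_cases ha : IsLast d a
  · apply le_antisymm
    · exact coxeterElt_of_isLast c ((hg.isLast_iff a).2 ha) ((hg.index_iff _ _).1 hidx')
    · have h1 := coxeterElt_of_isLast d ha hpre
      have h2 := (hg.le_iff (hidx'.trans hpre.symm)).1 h1
      rwa [apply_inv_apply] at h2
  · obtain ⟨j, hj, rfl⟩ := exists_lo_of_not_isLast d a ha
    rw [coxeterElt_lo hj]
    have hj' := (isParabolicIndex_iff d j).1 hj
    have h1 : g (lo j) < g (hi j) := hg.incOn _ _ hj' (lo_lt_hi j)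
    obtain ⟨i, hi', hi''⟩ := exists_lo_of_not_isLast c _ (mt (hg.isLast_iff _).1 ha)
    rw [← hi'', coxeterElt_lo hi']
    have h3 : d.index (g⁻¹ (hi i)) = d.index (lo j) := by
      rw [hg.index_iff, ← hi'', apply_inv_apply]
      exact ((isParabolicIndex_iff c i).1 hi').symm
    apply le_antisymm
    · rw [← hi''] at h1
      simp only [lo, hi, Fin.lt_def, Fin.le_def] at h1 ⊢
      exact h1
    · have h4 : lo j < g⁻¹ (hi i) := by
        by_contra h
        have := (hg.le_iff h3).1 (not_lt.1 h)
        rw [apply_inv_apply, ← hi''] at this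
        exact this.not_gt (lo_lt_hi i)
      have h5 : hi j ≤ g⁻¹ (hi i) := by
        simp only [lo, hi, Fin.lt_def, Fin.le_def] at h4 ⊢
        exact h4
      have := (hg.le_iff (hj'.symm.trans h3.symm)).1 h5
      rwa [apply_inv_apply] at this

/-! ### Multiplication of basis elements -/

theorem gen_mul_T {n : ℕ} (j : Fin (n - 1)) (w : Equiv.Perm (Fin n)) :
    gen j * T w = T (simple j * w) + xi (Desc j w) • T w := by
  apply orbitMap_injective n
  rw [map_add, map_smul, orbitMap_gen_mul, orbitMap_T, orbitMap_T, lop_e]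

theorem T_mul_T {n : ℕ} {x y : Equiv.Perm (Fin n)} (h : len (x * y) = len x + len y) :
    T x * T y = T (x * y) := by
  obtain ⟨l, hl⟩ := exists_reducedWord x
  obtain ⟨l', hl'⟩ := exists_reducedWord y
  have h1 : IsReducedWord (x * y) (l ++ l') :=
    ⟨by rw [wordProd_append, hl.1, hl'.1], by rw [List.length_append, hl.2, hl'.2, h]⟩
  rw [T_eq_of_isReducedWord hl, T_eq_of_isReducedWord hl', T_eq_of_isReducedWord h1, wordGen,
    wordGen, wordGen, List.map_append, List.prod_append]

theorem T_inv_mul_T_inv {n : ℕ} {x y : Equiv.Perm (Fin n)} (h : len (x * y) = len x + len y) :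
    T y⁻¹ * T x⁻¹ = T (x * y)⁻¹ := by
  rw [mul_inv_rev]
  apply T_mul_T
  rw [← mul_inv_rev, len_inv, len_inv, len_inv, h, add_comm]

theorem len_simple {n : ℕ} (j : Fin (n - 1)) : len (simple j : Equiv.Perm (Fin n)) = 1 := by
  have := len_simple_mul (not_desc_one j)
  rwa [mul_one, len_eq_invCount 1, invCount_one] at this

theorem T_simple {n : ℕ} (j : Fin (n - 1)) : T (simple j : Equiv.Perm (Fin n)) = gen j := by
  rw [T_eq_of_isReducedWord (l := [j]) ⟨by simp, by rw [len_simple]; rfl⟩]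
  simp [wordGen]

theorem T_mul_gen {n : ℕ} (j : Fin (n - 1)) (w : Equiv.Perm (Fin n)) :
    T w * gen j = T (w * simple j) + xi (Desc j w⁻¹) • T w := by
  have key : ∀ w : Equiv.Perm (Fin n), ¬ Desc j w⁻¹ → T w * gen j = T (w * simple j) := by
    intro w hw
    rw [← T_simple]
    apply T_mul_T
    rw [← len_inv, mul_inv_rev, simple_inv, len_simple_mul hw, len_inv, len_simple]
  by_cases h : Desc j w⁻¹
  · have h1 : ¬ Desc j (w * simple j)⁻¹ := by
      rw [mul_inv_rev, simple_inv, desc_simple_mul]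
      exact not_not.2 h
    have h2 := key _ h1
    rw [mul_simple_cancel] at h2
    conv_lhs => rw [← h2]
    rw [mul_assoc, gen_quad, mul_add, mul_one, mul_smul_comm, h2]
    simp [xi, h]
  · rw [key w h]
    simp [xi, h]

theorem heckeLinearMap_ext {n : ℕ} {M : Type*} [AddCommMonoid M] [Module ℤ[X] M]
    {A B : Hecke n →ₗ[ℤ[X]] M} (h : ∀ w, A (T w) = B (T w)) : A = B :=
  (heckeBasis n).ext fun w => by rw [heckeBasis_apply, h]

/-- Distinct letters in increasing order form a reduced word. -/
theorem len_wordProd_of_sorted {n : ℕ} (l : List (Fin (n - 1))) (hl : l.Pairwise (· < ·)) :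
    len (wordProd l) = l.length := by
  induction l with
  | nil => rw [wordProd_nil, len_eq_invCount, invCount_one]; rfl
  | cons i l ih =>
    rw [List.pairwise_cons] at hl
    rw [wordProd_cons, List.length_cons, ← ih hl.2]
    apply len_simple_mul
    intro hd
    have hfix : ∀ a : Fin n, a ≤ lo i → wordProd l a = a := fun a ha =>
      wordProd_apply_of_lt l a fun k hk => lt_of_le_of_lt ha (hl.1 k hk)
    have h1 : (wordProd l)⁻¹ (lo i) = lo i := by
      rw [Equiv.Perm.inv_eq_iff_eq, hfix _ le_rfl]
    simp only [Desc, h1] at hd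
    have h2 := hfix _ hd.le
    rw [apply_inv_apply] at h2
    rw [← h2] at hd
    exact hd.not_gt (lo_lt_hi i)

theorem T_coxeterElt {n : ℕ} (c : Composition n) :
    T (coxeterElt c) = wordGen (parabolicWord c) :=
  T_eq_of_isReducedWord ⟨rfl, (len_wordProd_of_sorted _ (parabolicWord_sorted c)).symm⟩

theorem wordGen_append {n : ℕ} (l l' : List (Fin (n - 1))) :
    (wordGen (l ++ l') : Hecke n) = wordGen l * wordGen l' := by simp [wordGen]

theorem wordGen_cons {n : ℕ} (i : Fin (n - 1)) (l : List (Fin (n - 1))) :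
    (wordGen (i :: l) : Hecke n) = gen i * wordGen l := by simp [wordGen]

/-! ### The projection onto a parabolic subalgebra -/

/-- The projection onto a parabolic subalgebra, with values in the whole Hecke algebra. -/
noncomputable def projEnd {n : ℕ} (lam : Composition n) : Hecke n →ₗ[ℤ[X]] Hecke n :=
  (parabolicAlg lam).val.toLinearMap ∘ₗ proj lam

theorem projEnd_apply {n : ℕ} (lam : Composition n) (h : Hecke n) :
    projEnd lam h = (proj lam h : Hecke n) := rfl

theorem projEnd_T_of_mem {n : ℕ} {lam : Composition n} {w : Equiv.Perm (Fin n)}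
    (h : w ∈ parabolic lam) : projEnd lam (T w) = T w := by
  classical
  rw [projEnd_apply, proj_T, if_pos h]

theorem projEnd_T_of_notMem {n : ℕ} {lam : Composition n} {w : Equiv.Perm (Fin n)}
    (h : w ∉ parabolic lam) : projEnd lam (T w) = 0 := by
  classical
  rw [projEnd_apply, proj_T, if_neg h]

theorem projEnd_gen_mul {n : ℕ} {lam : Composition n} {j : Fin (n - 1)}
    (hj : IsParabolicIndex lam j) (h : Hecke n) :
    projEnd lam (gen j * h) = gen j * projEnd lam h := by
  have : projEnd lam ∘ₗ LinearMap.mulLeft ℤ[X] (gen j) =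
      LinearMap.mulLeft ℤ[X] (gen j) ∘ₗ projEnd lam := by
    apply heckeLinearMap_ext
    intro w
    simp only [LinearMap.comp_apply, LinearMap.mulLeft_apply]
    have h1 : simple j * w ∈ parabolic lam ↔ w ∈ parabolic lam :=
      Subgroup.mul_mem_cancel_left _ (simple_mem_parabolic hj)
    rw [gen_mul_T, map_add, map_smul]
    by_cases hw : w ∈ parabolic lam
    · rw [projEnd_T_of_mem hw, projEnd_T_of_mem (h1.2 hw), gen_mul_T]
    · rw [projEnd_T_of_notMem hw, projEnd_T_of_notMem fun h => hw (h1.1 h)]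
      simp
  exact LinearMap.congr_fun this h

theorem projEnd_mul_gen {n : ℕ} {lam : Composition n} {j : Fin (n - 1)}
    (hj : IsParabolicIndex lam j) (h : Hecke n) :
    projEnd lam (h * gen j) = projEnd lam h * gen j := by
  have : projEnd lam ∘ₗ LinearMap.mulRight ℤ[X] (gen j) =
      LinearMap.mulRight ℤ[X] (gen j) ∘ₗ projEnd lam := by
    apply heckeLinearMap_ext
    intro w
    simp only [LinearMap.comp_apply, LinearMap.mulRight_apply]
    have h1 : w * simple j ∈ parabolic lam ↔ w ∈ parabolic lam :=
      Subgroup.mul_mem_cancel_right _ (simple_mem_parabolic hj)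
    rw [T_mul_gen, map_add, map_smul]
    by_cases hw : w ∈ parabolic lam
    · rw [projEnd_T_of_mem hw, projEnd_T_of_mem (h1.2 hw), T_mul_gen]
    · rw [projEnd_T_of_notMem hw, projEnd_T_of_notMem fun h => hw (h1.1 h)]
      simp
  exact LinearMap.congr_fun this h

theorem projEnd_mem_mul {n : ℕ} {lam : Composition n} {x : Hecke n} (hx : x ∈ parabolicAlg lam)
    (h : Hecke n) : projEnd lam (x * h) = x * projEnd lam h := by
  induction hx using Algebra.adjoin_induction generalizing h with
  | mem x hx => obtain ⟨j, hj, rfl⟩ := hx; exact projEnd_gen_mul hj h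
  | algebraMap r => rw [← Algebra.smul_def, ← Algebra.smul_def, map_smul]
  | add x y _ _ hx hy => rw [add_mul, add_mul, map_add, hx, hy]
  | mul x y _ _ hx hy => rw [mul_assoc, hx, hy, mul_assoc]

theorem projEnd_mul_mem {n : ℕ} {lam : Composition n} {x : Hecke n} (hx : x ∈ parabolicAlg lam)
    (h : Hecke n) : projEnd lam (h * x) = projEnd lam h * x := by
  induction hx using Algebra.adjoin_induction generalizing h with
  | mem x hx => obtain ⟨j, hj, rfl⟩ := hx; exact projEnd_mul_gen hj h
  | algebraMap r =>
    rw [← Algebra.commutes, ← Algebra.commutes, ← Algebra.smul_def, ← Algebra.smul_def, map_smul]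
  | add x y _ _ hx hy => rw [mul_add, mul_add, map_add, hx, hy]
  | mul x y _ _ hx hy => rw [← mul_assoc, hy, hx, mul_assoc]

theorem index_inv_eq_of_inv_mul_mem {n : ℕ} {lam : Composition n} {g w : Equiv.Perm (Fin n)}
    (h : g⁻¹ * w ∈ parabolic lam) (v : Fin n) : lam.index (w⁻¹ v) = lam.index (g⁻¹ v) := by
  rw [← (mem_parabolic_iff lam _).1 h, Equiv.Perm.mul_apply, apply_inv_apply]

/-- For `g` increasing on the blocks, the projection of `T_{g⁻¹} T_w` is the basis element
`T_{g⁻¹ w}` if `g⁻¹ w` lies in the parabolic subgroup. -/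
theorem projEnd_T_inv_mul_T {n : ℕ} {lam : Composition n} {g : Equiv.Perm (Fin n)}
    (hg : IncOn lam g) (w : Equiv.Perm (Fin n)) :
    projEnd lam (T g⁻¹ * T w) = projEnd lam (T (g⁻¹ * w)) := by
  induction hk : len g using Nat.strong_induction_on generalizing g w with
  | _ k ih =>
    by_cases h1 : ∀ i, ¬ Desc i g
    · rw [eq_one_of_no_desc g h1, T_mul_T]
      rw [inv_one, one_mul, len_eq_invCount 1, invCount_one, zero_add]
    · push Not at h1
      obtain ⟨j, hj⟩ := h1
      have h2 := len_of_desc hj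
      -- The letters `g⁻¹ (lo j)` and `g⁻¹ (hi j)` lie in different blocks, because `g` inverts
      -- their order.
      have hlt : lam.index (g⁻¹ (hi j)) < lam.index (g⁻¹ (lo j)) := by
        refine lt_of_le_of_ne (index_mono lam (le_of_lt hj)) fun he => ?_
        have := hg _ _ he hj
        rw [apply_inv_apply, apply_inv_apply] at this
        exact this.not_gt (lo_lt_hi j)
      have hg' : IncOn lam (simple j * g) := by
        intro a b hab hlt'
        refine simple_lt j (hg a b hab hlt') ?_
        rintro ⟨ha, hb⟩
        rw [← ha, ← hb, inv_apply_apply, inv_apply_apply, hab] at hlt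
        exact hlt.ne rfl
      have h3 : T g⁻¹ = T (simple j * g)⁻¹ * gen j := by
        rw [← T_simple]
        have := T_inv_mul_T_inv (x := simple j) (y := simple j * g)
          (by rw [simple_mul_cancel, len_simple]; omega)
        rw [simple_mul_cancel, simple_inv] at this
        exact this.symm
      have h4 : projEnd lam (xi (Desc j w) • (T (simple j * g)⁻¹ * T w)) = 0 := by
        by_cases hd : Desc j w
        · rw [map_smul, ih _ (by omega) hg' w rfl, projEnd_T_of_notMem, smul_zero]
          intro hmem
          have h5 : lam.index (w⁻¹ (lo j)) < lam.index (w⁻¹ (hi j)) := by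
            rw [index_inv_eq_of_inv_mul_mem hmem, index_inv_eq_of_inv_mul_mem hmem]
            simpa only [mul_inv_rev, simple_inv, Equiv.Perm.mul_apply, simple_lo, simple_hi]
              using hlt
          exact h5.not_ge (index_mono lam (le_of_lt hd))
        · simp [xi, hd]
      rw [h3, mul_assoc, gen_mul_T, mul_add, mul_smul_comm, map_add, h4, add_zero,
        ih _ (by omega) hg' _ rfl]
      congr 2
      rw [mul_inv_rev, simple_inv, mul_assoc, simple_mul_cancel]

theorem gen_mul_mem_span {n : ℕ} {A B : Set (Equiv.Perm (Fin n))} {j : Fin (n - 1)}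
    (h1 : ∀ w ∈ A, simple j * w ∈ B) (h2 : ∀ w ∈ A, Desc j w → w ∈ B) {x : Hecke n}
    (hx : x ∈ Submodule.span ℤ[X] (T '' A)) : gen j * x ∈ Submodule.span ℤ[X] (T '' B) := by
  induction hx using Submodule.span_induction with
  | mem x hx =>
    obtain ⟨w, hw, rfl⟩ := hx
    rw [gen_mul_T]
    refine add_mem (Submodule.subset_span ⟨_, h1 w hw, rfl⟩) ?_
    by_cases hd : Desc j w
    · exact Submodule.smul_mem _ _ (Submodule.subset_span ⟨_, h2 w hw hd, rfl⟩)
    · simp [xi, hd]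
  | zero => simp
  | add x y _ _ hx hy => rw [mul_add]; exact add_mem hx hy
  | smul r x _ hx => rw [mul_smul_comm]; exact Submodule.smul_mem _ _ hx

theorem wordGen_mul_mem_span {n : ℕ} {A : Set (Equiv.Perm (Fin n))} (l : List (Fin (n - 1)))
    (h : ∀ j ∈ l, ∀ w ∈ A, simple j * w ∈ A) {x : Hecke n}
    (hx : x ∈ Submodule.span ℤ[X] (T '' A)) : wordGen l * x ∈ Submodule.span ℤ[X] (T '' A) := by
  induction l with
  | nil => simpa [wordGen] using hx
  | cons j l ih =>
    rw [wordGen_cons, mul_assoc]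
    exact gen_mul_mem_span (h j (by simp)) (fun w hw _ => hw)
      (ih fun i hi => h i (by simp [hi]))

theorem apply_simple_eq {n : ℕ} {κ : Fin n → ℕ} {j : Fin (n - 1)}
    (h : κ (lo j) = κ (hi j)) (v : Fin n) : κ (simple j v) = κ v := by
  by_cases h1 : v = lo j
  · rw [h1, simple_lo, h]
  by_cases h2 : v = hi j
  · rw [h2, simple_hi, h]
  rw [simple, Equiv.swap_apply_of_ne_of_ne h1 h2]

/-- Colour the letter `v` by the block of `lam` that contains `g⁻¹ v`, and suppose that in each
block of `c` the last letter has the greatest colour. If some block of `c` is not monochromatic,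
the projection of `T_{g⁻¹} T_{w_c} T_g` vanishes.

The letters of the word for `w_c` act from the greatest to the smallest. The first one that
exchanges letters of different colours must exchange them, since they are in increasing order; no
later letter of the word moves the greater one, so that its colour remains wrong. -/
theorem projEnd_eq_zero_of_not_monochromatic {n : ℕ} {lam c : Composition n}
    {g : Equiv.Perm (Fin n)} (hg : IncOn lam g)
    (hmax : ∀ a b, c.index a = c.index b → IsLast c b → lam.index (g⁻¹ a) ≤ lam.index (g⁻¹ b))
    (hmono : ¬ ∀ a b, c.index a = c.index b → lam.index (g⁻¹ a) = lam.index (g⁻¹ b)) :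
    projEnd lam (T g⁻¹ * (T (coxeterElt c) * T g)) = 0 := by
  classical
  have hex : (Finset.univ.filter fun j : Fin (n - 1) => IsParabolicIndex c j ∧
      lam.index (g⁻¹ (lo j)) ≠ lam.index (g⁻¹ (hi j))).Nonempty := by
    by_contra hne
    rw [Finset.not_nonempty_iff_eq_empty, Finset.filter_eq_empty_iff] at hne
    have h1 : ∀ a b, a < b → c.index a = c.index b → lam.index (g⁻¹ a) = lam.index (g⁻¹ b) := by
      intro a b hab h
      refine block_induction c (r := fun a b => lam.index (g⁻¹ a) = lam.index (g⁻¹ b))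
        (fun x y z => Eq.trans) (fun j hj => ?_) hab h
      by_contra h2
      exact hne (Finset.mem_univ j) ⟨hj, h2⟩
    apply hmono
    intro a b h
    rcases lt_trichotomy a b with h2 | rfl | h2
    · exact h1 a b h2 h
    · rfl
    · exact (h1 b a h2 h.symm).symm
  obtain ⟨j, hj, hjmax⟩ := Finset.exists_max_image _ id hex
  simp only [Finset.mem_filter, Finset.mem_univ, true_and, id] at hj hjmax
  obtain ⟨hjc, hjne⟩ := hj
  have habove : ∀ i, IsParabolicIndex c i → j < i →
      lam.index (g⁻¹ (lo i)) = lam.index (g⁻¹ (hi i)) := by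
    intro i hi' hji
    by_contra h
    exact (hjmax i ⟨hi', h⟩).not_gt hji
  -- From `hi j` to the last letter of its block, all letters have the same, greatest, colour.
  have hlt : lam.index (g⁻¹ (lo j)) < lam.index (g⁻¹ (hi j)) := by
    refine lt_of_le_of_ne ?_ hjne
    obtain ⟨b, hb, hblast⟩ := exists_isLast c (hi j)
    have h1 : lam.index (g⁻¹ (hi j)) = lam.index (g⁻¹ b) := by
      rcases (hblast (hi j) hb.symm).eq_or_lt with h | h
      · rw [h]
      · refine (block_induction c
          (r := fun x y => x ≤ y ∧ (hi j ≤ x → lam.index (g⁻¹ x) = lam.index (g⁻¹ y)))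
          ?_ ?_ h hb.symm).2 le_rfl
        · rintro x y z ⟨h1, h2⟩ ⟨h3, h4⟩
          exact ⟨h1.trans h3, fun h => (h2 h).trans (h4 (h.trans h1))⟩
        · refine fun i hi' => ⟨lo_le_hi i, fun h => habove i hi' ?_⟩
          simp only [lo, hi, Fin.le_def] at h
          exact h
    rw [h1]
    exact hmax _ _ (((isParabolicIndex_iff c j).1 hjc).trans hb.symm) hblast
  obtain ⟨l₁, l₂, hl, hl₁, hl₂⟩ := exists_sorted_split _ (parabolicWord_sorted c)
    (mem_parabolicWord.2 hjc)
  have hmem₂ : ∀ i ∈ l₂, IsParabolicIndex c i := fun i hi' =>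
    mem_parabolicWord.1 (by rw [hl]; simp [hi'])
  -- `A` is the coset of the permutations with the same colours as `g`; in `B` the colour of `hi j` is
  -- wrong.
  let A : Set (Equiv.Perm (Fin n)) := {w | ∀ v, lam.index (w⁻¹ v) = lam.index (g⁻¹ v)}
  let B : Set (Equiv.Perm (Fin n)) := {w | lam.index (w⁻¹ (hi j)) ≠ lam.index (g⁻¹ (hi j))}
  have s1 : wordGen l₂ * T g ∈ Submodule.span ℤ[X] (T '' A) := by
    refine wordGen_mul_mem_span l₂ ?_ (Submodule.subset_span ⟨g, fun v => rfl, rfl⟩)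
    intro i hi' w hw v
    rw [mul_inv_rev, simple_inv, Equiv.Perm.mul_apply, hw]
    exact Fin.ext (apply_simple_eq (κ := fun v => (lam.index (g⁻¹ v) : ℕ))
      (congrArg Fin.val (habove i (hmem₂ i hi') (hl₂ i hi'))) v)
  have s2 : gen j * (wordGen l₂ * T g) ∈ Submodule.span ℤ[X] (T '' B) := by
    refine gen_mul_mem_span ?_ ?_ s1
    · intro w hw
      change lam.index ((simple j * w)⁻¹ (hi j)) ≠ _
      rw [mul_inv_rev, simple_inv, Equiv.Perm.mul_apply, simple_hi, hw]
      exact hjne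
    · intro w hw hd
      have := index_mono lam (le_of_lt hd)
      rw [hw, hw] at this
      exact absurd hlt this.not_gt
  have s3 : wordGen l₁ * (gen j * (wordGen l₂ * T g)) ∈ Submodule.span ℤ[X] (T '' B) := by
    refine wordGen_mul_mem_span l₁ ?_ s2
    intro i hi' w hw
    change lam.index ((simple i * w)⁻¹ (hi j)) ≠ _
    have h1 : simple i (hi j : Fin n) = hi j := by
      have := hl₁ i hi'
      rw [Fin.lt_def] at this
      apply Fin.ext
      have h2 : ((hi j : Fin n) : ℕ) = j + 1 := rfl
      rw [simple_val, if_neg (by omega), if_neg (by omega)]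
    rw [mul_inv_rev, simple_inv, Equiv.Perm.mul_apply, h1]
    exact hw
  have s4 : T (coxeterElt c) * T g = wordGen l₁ * (gen j * (wordGen l₂ * T g)) := by
    rw [T_coxeterElt, hl, wordGen_append, wordGen_cons, mul_assoc, mul_assoc]
  rw [s4]
  generalize wordGen l₁ * (gen j * (wordGen l₂ * T g)) = x at s3
  induction s3 using Submodule.span_induction with
  | mem x hx =>
    obtain ⟨w, hw, rfl⟩ := hx
    rw [projEnd_T_inv_mul_T hg, projEnd_T_of_notMem]
    exact fun h => hw (index_inv_eq_of_inv_mul_mem h _)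
  | zero => simp
  | add x y _ _ hx hy => rw [mul_add, map_add, hx, hy, add_zero]
  | smul r x _ hx => rw [mul_smul_comm, map_smul, hx, smul_zero]

theorem incOn_inv_of_monochromatic {n : ℕ} {lam c : Composition n} {g : Equiv.Perm (Fin n)}
    (hg : IncOn lam g)
    (hmono : ∀ a b, c.index a = c.index b → lam.index (g⁻¹ a) = lam.index (g⁻¹ b)) :
    IncOn c g⁻¹ := by
  intro a b hab hlt
  by_contra h
  rcases (not_lt.1 h).eq_or_lt with h | h
  · exact hlt.ne (g⁻¹.injective h.symm)
  · have := hg _ _ (hmono b a hab.symm) h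
    rw [apply_inv_apply, apply_inv_apply] at this
    exact this.not_gt hlt

/-- If all blocks of `c` are monochromatic, then `T_{g⁻¹} T_{w_c} T_g` projects to the basis
element of the conjugate of the Coxeter element. -/
theorem projEnd_of_monochromatic {n : ℕ} {lam c : Composition n} {g : Equiv.Perm (Fin n)}
    (hg : IncOn lam g)
    (hmono : ∀ a b, c.index a = c.index b → lam.index (g⁻¹ a) = lam.index (g⁻¹ b)) :
    projEnd lam (T g⁻¹ * (T (coxeterElt c) * T g)) = T (g⁻¹ * coxeterElt c * g) := by
  rw [T_mul_T (len_mul_of_incOn (coxeterElt_mem c) (incOn_inv_of_monochromatic hg hmono)),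
    projEnd_T_inv_mul_T hg, ← mul_assoc, projEnd_T_of_mem]
  rw [mem_parabolic_iff]
  intro a
  rw [Equiv.Perm.mul_apply, Equiv.Perm.mul_apply, hmono _ (g a) (index_coxeterElt c _),
    inv_apply_apply]

/-! ### Norms of Coxeter class elements -/

/-- In each block of `c`, the last letter has the greatest image under `y⁻¹`. -/
def LastMax {n : ℕ} (c : Composition n) (y : Equiv.Perm (Fin n)) : Prop :=
  ∀ a b, c.index a = c.index b → IsLast c b → y⁻¹ a ≤ y⁻¹ b

theorem lastMax_mul_iff {n : ℕ} {c d : Composition n} {g : Equiv.Perm (Fin n)}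
    (hg : CarriesBlocks g d c) (x : Equiv.Perm (Fin n)) : LastMax c (g * x) ↔ LastMax d x := by
  simp only [LastMax, mul_inv_rev, Equiv.Perm.mul_apply]
  constructor
  · intro h a b hab hb
    have := h (g a) (g b) ((hg.index_iff _ _).1 hab) ((hg.isLast_iff b).2 hb)
    rwa [inv_apply_apply, inv_apply_apply] at this
  · intro h a b hab hb
    refine h _ _ ?_ ?_
    · rw [hg.index_iff, apply_inv_apply, apply_inv_apply, hab]
    · rw [← hg.isLast_iff, apply_inv_apply]
      exact hb

open Classical in
/-- The norm of a Coxeter class element as a single sum of conjugates of the basis element of the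
Coxeter element. -/
theorem relNorm_eta {n : ℕ} (c : Composition n) (K : Subgroup (Equiv.Perm (Fin n)))
    (hK : parabolic c ≤ K) :
    relNorm K (parabolic c) (eta c) =
      ∑ y ∈ Finset.univ.filter fun y => y ∈ K ∧ LastMax c y,
        T y⁻¹ * T (coxeterElt c) * T y := by
  simp only [relNorm, eta, Finset.mul_sum, Finset.sum_mul]
  rw [← Finset.sum_product' (distinguished K (parabolic c))
    (distinguished (parabolic (subOne c)) ⊥)
    (fun d u => T d⁻¹ * (T u⁻¹ * T (coxeterElt c) * T u) * T d)]
  -- `u * d` determines `u` and `d`; the factor `u` fixes the last letters of the blocks exactly when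
  -- `(u * d)⁻¹` attains its maxima there, since `d⁻¹` is increasing on the blocks.
  refine Finset.sum_bij (fun p _ => p.2 * p.1) ?_ ?_ ?_ ?_
  · rintro ⟨d, u⟩ hp
    rw [Finset.mem_product, mem_distinguished_bot, mem_distinguished_parabolic,
      mem_parabolic_subOne_iff] at hp
    obtain ⟨⟨hdK, hd⟩, hu, hfix⟩ := hp
    simp only [Finset.mem_filter, Finset.mem_univ, true_and]
    refine ⟨mul_mem (hK hu) hdK, fun a b hab hb => ?_⟩
    have h1 : u⁻¹ b = b := by rw [Equiv.Perm.inv_eq_iff_eq, hfix b hb]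
    rw [mul_inv_rev, Equiv.Perm.mul_apply, Equiv.Perm.mul_apply, h1]
    have h2 : c.index (u⁻¹ a) = c.index b := by rw [index_inv hu, hab]
    rcases (hb _ h2).eq_or_lt with h3 | h3
    · rw [h3]
    · exact (hd _ _ h2 h3).le
  · rintro ⟨d, u⟩ hp ⟨d', u'⟩ hp' h
    rw [Finset.mem_product, mem_distinguished_bot, mem_distinguished_parabolic,
      mem_parabolic_subOne_iff] at hp hp'
    obtain ⟨h1, h2⟩ := factorization_unique hp.2.1 hp'.2.1 hp.1.2 hp'.1.2 h
    exact Prod.ext h2 h1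
  · intro y hy
    simp only [Finset.mem_filter, Finset.mem_univ, true_and] at hy
    obtain ⟨u, hu, d, hd, rfl⟩ := exists_factorization c y
    refine ⟨(d, u), ?_, rfl⟩
    rw [Finset.mem_product, mem_distinguished_bot, mem_distinguished_parabolic,
      mem_parabolic_subOne_iff]
    refine ⟨⟨?_, hd⟩, hu, fun b hb => ?_⟩
    · rw [← inv_mul_cancel_left u d]
      exact mul_mem (inv_mem (hK hu)) hy.1
    · have h1 : c.index (u⁻¹ b) = c.index b := index_inv hu b
      have h2 := hy.2 (u b) b ((mem_parabolic_iff c u).1 hu b) hb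
      rw [mul_inv_rev, Equiv.Perm.mul_apply, Equiv.Perm.mul_apply, inv_apply_apply] at h2
      rcases (hb _ h1).eq_or_lt with h3 | h3
      · rw [Equiv.Perm.inv_eq_iff_eq] at h3
        exact h3.symm
      · exact absurd (hd _ _ h1 h3) h2.not_gt
  · rintro ⟨d, u⟩ hp
    rw [Finset.mem_product, mem_distinguished_bot, mem_distinguished_parabolic,
      mem_parabolic_subOne_iff] at hp
    have h1 := len_mul_of_incOn hp.2.1 hp.1.2
    rw [← T_mul_T h1, ← T_inv_mul_T_inv h1]
    simp only [mul_assoc]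

/-! ### Sizes of blocks -/

theorem card_index_eq {n : ℕ} (c : Composition n) (k : Fin c.length) :
    (Finset.univ.filter fun a => c.index a = k).card = c.blocksFun k := by
  classical
  have : (Finset.univ.filter fun a => c.index a = k) =
      Finset.univ.map (c.embedding k).toEmbedding := by
    ext a
    simp only [Finset.mem_filter, Finset.mem_univ, true_and, Finset.mem_map]
    constructor
    · rintro rfl
      exact ⟨_, c.embedding_comp_inv a⟩
    · rintro ⟨r, rfl⟩
      exact c.index_embedding k r
  rw [this, Finset.card_map, Finset.card_univ, Fintype.card_fin]

theorem card_filter_index {n : ℕ} (c : Composition n) (P : Fin c.length → Prop) [DecidablePred P] :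
    (Finset.univ.filter fun a => P (c.index a)).card =
      ∑ k ∈ Finset.univ.filter P, c.blocksFun k := by
  classical
  rw [Finset.card_eq_sum_card_fiberwise (f := c.index) (t := Finset.univ.filter P)]
  · refine Finset.sum_congr rfl fun k hk => ?_
    rw [← card_index_eq, Finset.filter_filter]
    congr 1
    ext a
    simp only [Finset.mem_filter, Finset.mem_univ, true_and] at hk ⊢
    exact ⟨fun h => h.2, fun h => ⟨h ▸ hk, h⟩⟩
  · intro a ha
    simpa using ha

theorem exists_index_eq {n : ℕ} (c : Composition n) (k : Fin c.length) : ∃ a, c.index a = k :=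
  ⟨c.embedding k ⟨0, c.one_le_blocksFun k⟩, c.index_embedding k _⟩

theorem coe_blocks_eq_map {n : ℕ} (c : Composition n) :
    (c.blocks : Multiset ℕ) = Finset.univ.val.map c.blocksFun := by
  rw [← c.ofFn_blocksFun, Fin.univ_val_map]

theorem count_blocks {n : ℕ} (c : Composition n) (k : ℕ) :
    c.blocks.count k = (Finset.univ.filter fun i => c.blocksFun i = k).card := by
  rw [← Multiset.coe_count, coe_blocks_eq_map, Multiset.count_map, Finset.card_def,
    Finset.filter_val]
  simp only [eq_comm]

theorem card_blocksFun_index_eq {n : ℕ} (c : Composition n) (k : ℕ) :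
    (Finset.univ.filter fun a => c.blocksFun (c.index a) = k).card = c.blocks.count k * k := by
  rw [card_filter_index c fun i => c.blocksFun i = k, count_blocks,
    Finset.sum_congr rfl fun i hi => (Finset.mem_filter.1 hi).2, Finset.sum_const, smul_eq_mul]

/-! ### The cycle type of a Coxeter element -/

theorem mem_support_coxeterElt {n : ℕ} (c : Composition n) (a : Fin n) :
    a ∈ (coxeterElt c).support ↔ 2 ≤ c.blocksFun (c.index a) := by
  rw [Equiv.Perm.mem_support, ← card_index_eq, ← Nat.lt_iff_add_one_le, Finset.one_lt_card_iff]
  simp only [Finset.mem_filter, Finset.mem_univ, true_and]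
  constructor
  · intro h
    exact ⟨_, a, index_coxeterElt c a, rfl, h⟩
  · rintro ⟨x, y, hx, hy, hxy⟩ h
    have key : ∀ z, c.index z = c.index a → z = a := by
      intro z hz
      obtain ⟨k, hk⟩ := (sameCycle_coxeterElt c a z).2 hz.symm
      rw [← hk]
      exact Function.IsFixedPt.perm_zpow h k
    exact hxy ((key x hx).trans (key y hy).symm)

theorem card_support_cycleOf_coxeterElt {n : ℕ} (c : Composition n) (a : Fin n)
    (h : 2 ≤ c.blocksFun (c.index a)) :
    ((coxeterElt c).cycleOf a).support.card = c.blocksFun (c.index a) := by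
  rw [← card_index_eq]
  congr 1
  ext b
  rw [Equiv.Perm.mem_support_cycleOf_iff, sameCycle_coxeterElt, mem_support_coxeterElt]
  simp [h, eq_comm]

theorem cycleType_coxeterElt {n : ℕ} (c : Composition n) :
    (coxeterElt c).cycleType = (c.blocks : Multiset ℕ).filter (2 ≤ ·) := by
  classical
  choose first hfirst using exists_index_eq c
  have himage : (coxeterElt c).cycleFactorsFinset =
      (Finset.univ.filter fun k => 2 ≤ c.blocksFun k).image
        fun k => (coxeterElt c).cycleOf (first k) := by
    ext σ
    simp only [Finset.mem_image, Finset.mem_filter, Finset.mem_univ, true_and]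
    constructor
    · intro hσ
      obtain ⟨a, ha⟩ := (Equiv.Perm.mem_cycleFactorsFinset_iff.1 hσ).1.nonempty_support
      have h1 := Equiv.Perm.cycle_is_cycleOf ha hσ
      rw [h1, Equiv.Perm.mem_support_cycleOf_iff, mem_support_coxeterElt] at ha
      refine ⟨c.index a, ha.2, ?_⟩
      rw [h1]
      exact ((sameCycle_coxeterElt c _ _).2 (hfirst _)).cycleOf_eq
    · rintro ⟨k, hk, rfl⟩
      rw [Equiv.Perm.cycleOf_mem_cycleFactorsFinset_iff, mem_support_coxeterElt, hfirst]
      exact hk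
  have hinj : Set.InjOn (fun k => (coxeterElt c).cycleOf (first k))
      (Finset.univ.filter fun k => 2 ≤ c.blocksFun k : Finset (Fin c.length)) := by
    intro k hk k' hk' h
    simp only [Finset.coe_filter, Finset.mem_univ, true_and, Set.mem_ofPred_eq] at hk hk' h
    have h1 : first k ∈ ((coxeterElt c).cycleOf (first k)).support := by
      rw [Equiv.Perm.mem_support_cycleOf_iff, mem_support_coxeterElt, hfirst]
      exact ⟨Equiv.Perm.SameCycle.refl _ _, hk⟩
    rw [h, Equiv.Perm.mem_support_cycleOf_iff, sameCycle_coxeterElt, hfirst, hfirst] at h1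
    exact h1.1.symm
  rw [Equiv.Perm.cycleType_def, himage, Finset.image_val_of_injOn hinj, Multiset.map_map,
    coe_blocks_eq_map, Multiset.filter_map]
  refine Multiset.map_congr ?_ fun k hk => ?_
  · rw [Finset.filter_val]; rfl
  · replace hk : 2 ≤ c.blocksFun k := (Multiset.mem_filter.1 hk).2
    have := card_support_cycleOf_coxeterElt c (first k) (by rw [hfirst]; exact hk)
    rw [hfirst] at this
    exact this

/-- A multiset of positive natural numbers is determined by its sum and by its members that are at
least two. -/
theorem multiset_eq_of_filter_eq {A B : Multiset ℕ} (hA : ∀ k ∈ A, 0 < k) (hB : ∀ k ∈ B, 0 < k)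
    (hsum : A.sum = B.sum) (h : A.filter (2 ≤ ·) = B.filter (2 ≤ ·)) : A = B := by
  have key : ∀ C : Multiset ℕ, (∀ k ∈ C, 0 < k) →
      C = C.filter (2 ≤ ·) + Multiset.replicate (C.sum - (C.filter (2 ≤ ·)).sum) 1 := by
    intro C hC
    have h1 : C.filter (fun k => ¬ 2 ≤ k) =
        Multiset.replicate (C.filter (fun k => ¬ 2 ≤ k)).card 1 := by
      refine Multiset.eq_replicate_card.2 fun k hk => ?_
      rw [Multiset.mem_filter] at hk
      have := hC k hk.1
      omega
    have h2 := Multiset.filter_add_not (fun k => 2 ≤ k) C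
    have h3 : C.sum - (C.filter (2 ≤ ·)).sum = (C.filter (fun k => ¬ 2 ≤ k)).card := by
      have h4 := congrArg Multiset.sum h2
      rw [Multiset.sum_add] at h4
      have h5 := congrArg Multiset.sum h1
      rw [Multiset.sum_replicate, smul_eq_mul, mul_one] at h5
      omega
    rw [h3, ← h1, h2]
  rw [key A hA, key B hB, hsum, h]

theorem parts_partition_coxeterElt {n : ℕ} (c : Composition n) :
    (coxeterElt c).partition.parts = (c.blocks : Multiset ℕ) := by
  refine multiset_eq_of_filter_eq (fun k hk => (coxeterElt c).partition.parts_pos hk)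
    (fun k hk => c.blocks_pos hk) ?_ ?_
  · rw [(coxeterElt c).partition.parts_sum, Fintype.card_fin, Multiset.sum_coe, c.blocks_sum]
  · rw [Equiv.Perm.filter_parts_partition_eq_cycleType, cycleType_coxeterElt]

theorem cycleClass_eq {n : ℕ} {c α : Composition n}
    (h : (c.blocks : Multiset ℕ) = (α.blocks : Multiset ℕ)) :
    cycleClass α = {w | ∃ g ∈ (⊤ : Subgroup (Equiv.Perm (Fin n))), w = g * coxeterElt c * g⁻¹} := by
  ext w
  simp only [cycleClass, Set.mem_ofPred_eq, Subgroup.mem_top, true_and]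
  rw [← h, ← parts_partition_coxeterElt, ← Nat.Partition.ext_iff, eq_comm,
    ← Equiv.Perm.partition_eq_of_isConj, isConj_iff]
  simp only [eq_comm]

/-! ### Counting -/

/-- The order of `H` is the number of `H`-conjugates of `v` times the number of elements
of `H` that conjugate `v` to a given one of them. -/
theorem card_eq_ncard_mul_card {G : Type*} [Group G] [Fintype G] [DecidableEq G]
    (H : Subgroup G) [DecidablePred (· ∈ H)] {u v : G} (hu : ∃ h ∈ H, u = h * v * h⁻¹) :
    Nat.card H = {w | ∃ h ∈ H, w = h * v * h⁻¹}.ncard *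
      (Finset.univ.filter fun h => h ∈ H ∧ h * v * h⁻¹ = u).card := by
  classical
  have h1 : Nat.card H = (Finset.univ.filter fun h => h ∈ H).card := by
    rw [Nat.card_eq_fintype_card, Fintype.card_subtype]
  have h2 : {w | ∃ h ∈ H, w = h * v * h⁻¹} =
      (((Finset.univ.filter fun h => h ∈ H).image fun h => h * v * h⁻¹ : Finset G) : Set G) := by
    ext w
    simp [eq_comm]
  rw [h1, h2, Set.ncard_coe_finset, Finset.card_eq_sum_card_image (fun h => h * v * h⁻¹),
    ← smul_eq_mul, ← Finset.sum_const]
  refine Finset.sum_congr rfl fun w hw => ?_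
  obtain ⟨a, ha, rfl⟩ := Finset.mem_image.1 hw
  rw [Finset.mem_filter] at ha
  obtain ⟨b, hb, rfl⟩ := hu
  rw [Finset.filter_filter]
  refine Finset.card_bij (fun h _ => b * a⁻¹ * h) ?_ ?_ ?_
  · intro h hh
    simp only [Finset.mem_filter, Finset.mem_univ, true_and] at hh ⊢
    refine ⟨mul_mem (mul_mem hb (inv_mem ha.2)) hh.1, ?_⟩
    calc b * a⁻¹ * h * v * (b * a⁻¹ * h)⁻¹ = b * a⁻¹ * (h * v * h⁻¹) * (b * a⁻¹)⁻¹ := by group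
      _ = b * v * b⁻¹ := by rw [hh.2]; group
  · intro x _ y _ hxy
    exact mul_left_cancel hxy
  · intro h hh
    simp only [Finset.mem_filter, Finset.mem_univ, true_and] at hh
    refine ⟨a * b⁻¹ * h, ?_, by group⟩
    simp only [Finset.mem_filter, Finset.mem_univ, true_and]
    refine ⟨mul_mem (mul_mem ha.2 (inv_mem hb)) hh.1, ?_⟩
    calc a * b⁻¹ * h * v * (a * b⁻¹ * h)⁻¹ = a * b⁻¹ * (h * v * h⁻¹) * (a * b⁻¹)⁻¹ := by group
      _ = a * v * a⁻¹ := by rw [hh.2]; group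

/-! ### Compositions derived from multipartitions -/

theorem isCut_derived {n : ℕ} {lam : Composition n} (θ : Multipartition lam) (p : ℕ) :
    IsCut (derived θ) p ↔
      p = 0 ∨ ∃ i : Fin lam.length, ∃ q, IsCut (θ i).1 q ∧ p = lam.sizeUpTo i + q := by
  have hsum : ∀ i, (((List.ofFn fun i => (θ i).1.blocks).take i).map List.sum).sum =
      lam.sizeUpTo i := by
    intro i
    rw [Composition.sizeUpTo, ← lam.ofFn_blocksFun, List.map_take, List.map_ofFn]
    congr 3
    ext i
    exact (θ i).1.blocks_sum
  rw [isCut_iff]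
  change IsPartialSum (List.ofFn fun i => (θ i).1.blocks).flatten p ↔ _
  rw [isPartialSum_flatten]
  refine or_congr_right ⟨?_, ?_⟩
  · rintro ⟨i, hi, q, hq, rfl⟩
    rw [List.length_ofFn] at hi
    rw [List.getElem_ofFn] at hq
    exact ⟨⟨i, hi⟩, q, hq, by rw [hsum]⟩
  · rintro ⟨i, q, hq, rfl⟩
    refine ⟨i, by simp, q, ?_, by rw [hsum]⟩
    rw [List.getElem_ofFn]
    exact hq

theorem isCut_le {n : ℕ} {c : Composition n} {p : ℕ} (h : IsCut c p) : p ≤ n := by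
  obtain ⟨i, rfl⟩ := h
  exact c.sizeUpTo_le i

theorem index_eq_of_index_derived_eq {n : ℕ} {lam : Composition n} (θ : Multipartition lam)
    (a b : Fin n) (h : (derived θ).index a = (derived θ).index b) : lam.index a = lam.index b := by
  have key : ∀ a b, a ≤ b → (derived θ).index a = (derived θ).index b →
      lam.index a = lam.index b := by
    intro a b hab h
    rw [index_eq_iff _ hab] at h ⊢
    rintro p h1 h2 ⟨i, rfl⟩
    rcases lt_or_ge i lam.length with h3 | h3
    · exact h _ h1 h2 ((isCut_derived θ _).2 (Or.inr ⟨⟨i, h3⟩, 0, ⟨0, by simp⟩, rfl⟩))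
    · rw [lam.sizeUpTo_ofLength_le i h3] at h2
      omega
  rcases le_total a b with h1 | h1
  · exact key a b h1 h
  · exact (key b a h1 h.symm).symm

theorem parabolic_derived_le {n : ℕ} {lam : Composition n} (θ : Multipartition lam) :
    parabolic (derived θ) ≤ parabolic lam :=
  parabolic_le_of_index (index_eq_of_index_derived_eq θ)

/-- Within one block of `lam`, the blocks of the derived composition are those of the member of
the multipartition. -/
theorem index_derived_eq_iff {n : ℕ} {lam : Composition n} (θ : Multipartition lam)
    {i : Fin lam.length} {a b : Fin n} (hab : a ≤ b) (ha : lam.index a = i)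
    (hb : lam.index b = i) :
    (derived θ).index a = (derived θ).index b ↔
      ∀ q, IsCut (θ i).1 q → (a : ℕ) < lam.sizeUpTo i + q → ¬ lam.sizeUpTo i + q ≤ b := by
  rw [index_eq_iff _ hab]
  constructor
  · intro h q hq h1 h2
    exact h _ h1 h2 ((isCut_derived θ _).2 (Or.inr ⟨i, q, hq, rfl⟩))
  · intro h p h1 h2 hp
    rcases (isCut_derived θ p).1 hp with rfl | ⟨j, q, hq, rfl⟩
    · omega
    · have h3 := lam.sizeUpTo_index_le a
      have h4 := lam.lt_sizeUpTo_index_succ b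
      rw [ha] at h3
      rw [hb] at h4
      have h5 := isCut_le hq
      have h6 := lam.sizeUpTo_succ' j
      simp only [Fin.val_succ] at h4
      rcases lt_trichotomy i j with h7 | rfl | h7
      · have := lam.monotone_sizeUpTo (Nat.succ_le_of_lt (Fin.lt_def.1 h7))
        simp only [Nat.succ_eq_add_one] at this
        omega
      · exact h q hq h1 h2
      · have := lam.monotone_sizeUpTo (Nat.succ_le_of_lt (Fin.lt_def.1 h7))
        simp only [Nat.succ_eq_add_one] at this
        omega

theorem index_derived_embedding {n : ℕ} {lam : Composition n} (θ : Multipartition lam)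
    (i : Fin lam.length) (p q : Fin (lam.blocksFun i)) :
    (derived θ).index (lam.embedding i p) = (derived θ).index (lam.embedding i q) ↔
      (θ i).1.index p = (θ i).1.index q := by
  have key : ∀ p q : Fin (lam.blocksFun i), p ≤ q →
      ((derived θ).index (lam.embedding i p) = (derived θ).index (lam.embedding i q) ↔
        (θ i).1.index p = (θ i).1.index q) := by
    intro p q hpq
    rw [index_derived_eq_iff θ ((lam.embedding i).le_iff_le.2 hpq) (lam.index_embedding i p)
      (lam.index_embedding i q), index_eq_iff _ hpq]
    simp only [Composition.coe_embedding, add_lt_add_iff_left, add_le_add_iff_left]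
    exact ⟨fun h r h1 h2 h3 => h r h3 h1 h2, fun h r h1 h2 h3 => h r h2 h3 h1⟩
  rcases le_total p q with h | h
  · exact key p q h
  · rw [eq_comm, key q p h, eq_comm]

theorem blocksFun_index_derived {n : ℕ} {lam : Composition n} (θ : Multipartition lam)
    (i : Fin lam.length) (p : Fin (lam.blocksFun i)) :
    (derived θ).blocksFun ((derived θ).index (lam.embedding i p)) =
      (θ i).1.blocksFun ((θ i).1.index p) := by
  classical
  rw [← card_index_eq (derived θ), ← card_index_eq (θ i).1,
    ← Finset.card_map (lam.embedding i).toEmbedding]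
  congr 1
  ext b
  simp only [Finset.mem_filter, Finset.mem_univ, true_and, Finset.mem_map,
    RelEmbedding.coe_toEmbedding]
  constructor
  · intro h
    have h1 := index_eq_of_index_derived_eq θ _ _ h
    rw [lam.index_embedding] at h1
    subst h1
    refine ⟨lam.invEmbedding b, ?_, lam.embedding_comp_inv b⟩
    rw [← index_derived_embedding, lam.embedding_comp_inv, h]
  · rintro ⟨q, hq, rfl⟩
    exact (index_derived_embedding θ i q p).2 hq

/-- The letters of the `i`-th block of `lam` that lie in blocks of size `k` of the derived
composition determine the multiplicity of the part `k`. -/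
theorem count_blocks_mul_eq {n : ℕ} {lam : Composition n} (θ : Multipartition lam)
    (i : Fin lam.length) (k : ℕ) :
    (θ i).1.blocks.count k * k = (Finset.univ.filter fun a => lam.index a = i ∧
      (derived θ).blocksFun ((derived θ).index a) = k).card := by
  classical
  rw [← card_blocksFun_index_eq, ← Finset.card_map (lam.embedding i).toEmbedding]
  congr 1
  ext b
  simp only [Finset.mem_filter, Finset.mem_univ, true_and, Finset.mem_map,
    RelEmbedding.coe_toEmbedding]
  constructor
  · rintro ⟨q, hq, rfl⟩
    exact ⟨lam.index_embedding i q, by rw [blocksFun_index_derived, hq]⟩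
  · rintro ⟨rfl, h⟩
    refine ⟨lam.invEmbedding b, ?_, lam.embedding_comp_inv b⟩
    rw [← blocksFun_index_derived, lam.embedding_comp_inv, h]

theorem composition_eq_of_count {n : ℕ} {c d : Composition n} (hc : IsPartition c)
    (hd : IsPartition d) (h : ∀ k, c.blocks.count k * k = d.blocks.count k * k) : c = d := by
  have hperm : c.blocks.Perm d.blocks := by
    rw [List.perm_iff_count]
    intro k
    rcases Nat.eq_zero_or_pos k with rfl | hk
    · rw [List.count_eq_zero_of_not_mem fun h => (c.blocks_pos h).ne rfl,
        List.count_eq_zero_of_not_mem fun h => (d.blocks_pos h).ne rfl]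
    · exact Nat.eq_of_mul_eq_mul_right hk (h k)
  exact Composition.ext (hperm.eq_of_pairwise (fun a b _ _ h1 h2 => le_antisymm h2 h1) hc hd)

/-- A multipartition is determined by the orbit of its blocks under the parabolic subgroup, since
the sizes of the blocks in each block of `lam` are the same throughout the orbit. -/
theorem multipartition_eq_of_index {n : ℕ} {lam : Composition n} {θ θ' : Multipartition lam}
    {y : Equiv.Perm (Fin n)} (hy : y ∈ parabolic lam)
    (h : ∀ a b, (derived θ).index a = (derived θ).index b ↔
      (derived θ').index (y a) = (derived θ').index (y b)) : θ = θ' := by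
  classical
  have hsize : ∀ a, (derived θ).blocksFun ((derived θ).index a) =
      (derived θ').blocksFun ((derived θ').index (y a)) := by
    intro a
    rw [← card_index_eq, ← card_index_eq, ← Finset.card_map y.toEmbedding]
    congr 1
    ext b
    simp only [Finset.mem_filter, Finset.mem_univ, true_and, Finset.mem_map,
      Equiv.coe_toEmbedding]
    constructor
    · rintro ⟨x, hx, rfl⟩
      exact (h _ _).1 hx
    · intro hb
      exact ⟨y⁻¹ b, by rw [h, apply_inv_apply, hb], apply_inv_apply y b⟩
  funext i
  apply Subtype.ext
  refine composition_eq_of_count (θ i).2 (θ' i).2 fun k => ?_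
  rw [count_blocks_mul_eq, count_blocks_mul_eq, ← Finset.card_map y.toEmbedding]
  congr 1
  ext b
  simp only [Finset.mem_filter, Finset.mem_univ, true_and, Finset.mem_map, Equiv.coe_toEmbedding]
  constructor
  · rintro ⟨x, ⟨hx, hx'⟩, rfl⟩
    exact ⟨by rw [(mem_parabolic_iff lam y).1 hy, hx], by rw [← hsize, hx']⟩
  · rintro ⟨hb, hb'⟩
    exact ⟨y⁻¹ b, ⟨by rw [index_inv hy, hb], by rw [hsize, apply_inv_apply, hb']⟩,
      apply_inv_apply y b⟩

/-! ### Colourings of blocks -/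

/-- `g` carries each block of `lam`, in an order preserving way, to the letters that have its colour
under the colouring `f` of the blocks of `α` by the blocks of `lam`. -/
def IsSorting {n : ℕ} {lam α : Composition n} (f : Fin α.length → Fin lam.length)
    (g : Equiv.Perm (Fin n)) : Prop :=
  IncOn lam g ∧ ∀ a, f (α.index (g a)) = lam.index a

/-- The colourings of the blocks of `α` by the blocks of `lam` that use each colour on as many
letters as the block of `lam` has. This condition is encoded by the existence of a permutation that
carries the blocks of `lam` to the colour classes. -/
abbrev Coloring {n : ℕ} (lam α : Composition n) : Type :=
  {f : Fin α.length → Fin lam.length // ∃ g, IsSorting f g}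

/-- The order preserving permutation belonging to a colouring. -/
noncomputable def Coloring.sorting {n : ℕ} {lam α : Composition n} (f : Coloring lam α) :
    Equiv.Perm (Fin n) := f.2.choose

theorem Coloring.incOn_sorting {n : ℕ} {lam α : Composition n} (f : Coloring lam α) :
    IncOn lam f.sorting := f.2.choose_spec.1

theorem Coloring.apply_index {n : ℕ} {lam α : Composition n} (f : Coloring lam α) (a : Fin n) :
    f.1 (α.index (f.sorting a)) = lam.index a := f.2.choose_spec.2 a

theorem Coloring.sorting_inv_mul_mem {n : ℕ} {lam α : Composition n} (f : Coloring lam α)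
    {y : Equiv.Perm (Fin n)} (hy : ∀ a, f.1 (α.index (y a)) = lam.index a) :
    f.sorting⁻¹ * y ∈ parabolic lam := by
  rw [mem_parabolic_iff]
  intro a
  rw [← f.apply_index, Equiv.Perm.mul_apply, apply_inv_apply, hy]

theorem Coloring.apply_index_of_mul {n : ℕ} {lam α : Composition n} (f : Coloring lam α)
    {x : Equiv.Perm (Fin n)} (hx : x ∈ parabolic lam) (a : Fin n) :
    f.1 (α.index a) = lam.index ((f.sorting * x)⁻¹ a) := by
  rw [mul_inv_rev, Equiv.Perm.mul_apply, index_inv hx, ← f.apply_index, apply_inv_apply]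

theorem Coloring.eq_of_sorting_mul_eq {n : ℕ} {lam α : Composition n} {f f' : Coloring lam α}
    {x x' : Equiv.Perm (Fin n)} (hx : x ∈ parabolic lam) (hx' : x' ∈ parabolic lam)
    (h : f.sorting * x = f'.sorting * x') : f = f' ∧ x = x' := by
  have hf : f = f' := by
    apply Subtype.ext
    funext k
    obtain ⟨a, rfl⟩ := exists_index_eq α k
    rw [f.apply_index_of_mul hx, f'.apply_index_of_mul hx', h]
  subst hf
  exact ⟨rfl, mul_left_cancel h⟩

/-- If `y⁻¹` carries each block of `α` into a block of `lam`, then `y` gives rise to a colouring. -/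
theorem exists_coloring {n : ℕ} {lam α : Composition n} {y : Equiv.Perm (Fin n)}
    (h : ∀ a b, α.index a = α.index b → lam.index (y⁻¹ a) = lam.index (y⁻¹ b)) :
    ∃ f : Coloring lam α, ∀ a, f.1 (α.index (y a)) = lam.index a := by
  choose first hfirst using exists_index_eq α
  have hf : ∀ a, lam.index (y⁻¹ (first (α.index (y a)))) = lam.index a := fun a => by
    rw [h _ (y a) (hfirst _), inv_apply_apply]
  obtain ⟨u, hu, d, hd, hy⟩ := exists_factorization lam y⁻¹
  refine ⟨⟨fun k => lam.index (y⁻¹ (first k)), d⁻¹, hd, fun a => ?_⟩, hf⟩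
  have h1 : d⁻¹ = y * u := by rw [← inv_inv y, hy]; group
  rw [h1, Equiv.Perm.mul_apply]
  exact (hf (u a)).trans ((mem_parabolic_iff lam u).1 hu a)

open Classical in
/-- The parts of `α` of colour `i` add up to the size of the `i`-th block of `lam`. -/
theorem Coloring.sum_eq {n : ℕ} {lam α : Composition n} (f : Coloring lam α)
    (i : Fin lam.length) :
    (((List.finRange α.length).filter fun k => f.1 k = i).map α.blocksFun).sum =
      lam.blocksFun i := by
  have h1 : (((List.finRange α.length).filter fun k => f.1 k = i).map α.blocksFun).sum =
      ∑ k ∈ Finset.univ.filter (fun k => f.1 k = i), α.blocksFun k := by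
    rw [Finset.sum, Finset.filter_val, ← Multiset.sum_coe, ← Multiset.map_coe, ← Multiset.filter_coe]
    rfl
  rw [h1, ← card_filter_index α fun k => f.1 k = i, ← card_index_eq,
    ← Finset.card_map f.sorting.toEmbedding (s := Finset.univ.filter fun a => lam.index a = i)]
  congr 1
  ext b
  simp only [Finset.mem_filter, Finset.mem_univ, true_and, Finset.mem_map, Equiv.coe_toEmbedding]
  constructor
  · intro h
    exact ⟨f.sorting⁻¹ b, by rw [← f.apply_index, apply_inv_apply, h], apply_inv_apply _ b⟩
  · rintro ⟨a, rfl, rfl⟩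
    exact f.apply_index a

open Classical in
/-- The multipartition belonging to a colouring: its `i`-th member consists of the parts of `α` of
colour `i`, in their order. -/
noncomputable def Coloring.multipartition {n : ℕ} {lam α : Composition n} (hα : IsPartition α)
    (f : Coloring lam α) : Multipartition lam := fun i =>
  ⟨{ blocks := ((List.finRange α.length).filter fun k => f.1 k = i).map α.blocksFun
     blocks_pos := by
      intro k hk
      obtain ⟨j, -, rfl⟩ := List.mem_map.1 hk
      exact α.one_le_blocksFun j
     blocks_sum := f.sum_eq i },
    by
      have h : ((List.finRange α.length).map α.blocksFun).Pairwise (· ≥ ·) := by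
        rw [← List.ofFn_eq_map, α.ofFn_blocksFun]
        exact hα
      exact List.pairwise_map.2 ((List.pairwise_map.1 h).filter _)⟩

theorem Coloring.derived_blocks {n : ℕ} {lam α : Composition n} (hα : IsPartition α)
    (f : Coloring lam α) :
    ((derived (f.multipartition hα)).blocks : Multiset ℕ) = (α.blocks : Multiset ℕ) := by
  classical
  rw [Multiset.coe_eq_coe, List.perm_iff_count]
  intro k
  change (List.ofFn fun i => ((List.finRange α.length).filter fun k => f.1 k = i).map
    α.blocksFun).flatten.count k = _
  rw [List.count_flatten, List.map_ofFn, List.sum_ofFn, count_blocks,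
    Finset.card_eq_sum_card_fiberwise (f := f.1) (t := Finset.univ) (by simp)]
  refine Finset.sum_congr rfl fun i _ => ?_
  rw [Function.comp_apply, ← Multiset.coe_count, ← Multiset.map_coe, ← Multiset.filter_coe,
    Multiset.count_map, Multiset.filter_filter, Finset.filter_filter, Finset.card_def,
    Finset.filter_val]
  congr 1
  refine Multiset.filter_congr fun j _ => ?_
  simp only [eq_comm]

open Classical in
/-- The sums of the first parts of `α` of colour `i` count the letters of the `i`-th block of `lam`
that the sorting permutation sends to the first blocks of `α`. -/
theorem Coloring.isCut_multipartition {n : ℕ} {lam α : Composition n} (hα : IsPartition α)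
    (f : Coloring lam α) (i : Fin lam.length) (q : ℕ) :
    IsCut (f.multipartition hα i).1 q ↔ ∃ k ≤ α.length,
      (Finset.univ.filter fun b => lam.index b = i ∧ (α.index (f.sorting b) : ℕ) < k).card = q := by
  rw [isCut_iff]
  change IsPartialSum (((List.finRange α.length).filter fun k => f.1 k = i).map α.blocksFun) q ↔ _
  rw [isPartialSum_filter_map, List.length_finRange]
  refine exists_congr fun k => and_congr_right fun hk => ?_
  have h1 : ((((List.finRange α.length).take k).filter fun k => f.1 k = i).map
      α.blocksFun).sum = ∑ j ∈ Finset.univ.filter (fun j => f.1 j = i ∧ (j : ℕ) < k),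
        α.blocksFun j := by
    rw [← List.sum_toFinset _ (((List.nodup_finRange _).sublist (List.take_sublist _ _)).filter _)]
    congr 1
    ext j
    simp only [List.mem_toFinset, List.mem_filter, Finset.mem_filter, Finset.mem_univ, true_and,
      decide_eq_true_eq, and_comm (a := f.1 j = i), List.mem_take_iff_getElem]
    refine and_congr_left fun _ => ⟨?_, fun h => ⟨j, by simp [h], by simp⟩⟩
    rintro ⟨r, hr, rfl⟩
    simp at hr ⊢
    omega
  rw [h1, ← card_filter_index α fun j => f.1 j = i ∧ (j : ℕ) < k]
  have h4 : (Finset.univ.filter fun a => f.1 (α.index a) = i ∧ (α.index a : ℕ) < k) =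
      (Finset.univ.filter fun b => lam.index b = i ∧
        (α.index (f.sorting b) : ℕ) < k).map f.sorting.toEmbedding := by
    ext b
    simp only [Finset.mem_filter, Finset.mem_univ, true_and, Finset.mem_map,
      Equiv.coe_toEmbedding]
    constructor
    · rintro ⟨h, h'⟩
      exact ⟨f.sorting⁻¹ b, ⟨by rw [← f.apply_index, apply_inv_apply, h],
        by rw [apply_inv_apply]; exact h'⟩, apply_inv_apply _ b⟩
    · rintro ⟨a, ⟨rfl, h⟩, rfl⟩
      exact ⟨f.apply_index a, h⟩
  rw [h4, Finset.card_map]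

/-- An initial segment of a block is described by its number of elements. -/
theorem lt_sizeUpTo_add_card_iff {n : ℕ} (c : Composition n) (i : Fin c.length)
    (P : Fin n → Prop) [DecidablePred P] (hP : ∀ a b, c.index a = i → c.index b = i → a ≤ b → P b → P a)
    (a : Fin n) (ha : c.index a = i) :
    (a : ℕ) < c.sizeUpTo i + (Finset.univ.filter fun b => c.index b = i ∧ P b).card ↔ P a := by
  have h1 := c.sizeUpTo_index_le a
  rw [ha] at h1
  let s : Fin n := ⟨c.sizeUpTo i, by omega⟩
  have hs : c.index s = i := index_eq_of_sizeUpTo c i s le_rfl (c.sizeUpTo_strict_mono i.2)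
  have hmin : ∀ b, c.index b = i → s ≤ b := by
    intro b hb
    have := c.sizeUpTo_index_le b
    rw [hb] at this
    exact this
  by_cases hPa : P a
  · have h2 : Finset.Icc s a ⊆ Finset.univ.filter fun b => c.index b = i ∧ P b := by
      intro b hb
      rw [Finset.mem_Icc] at hb
      have hb' : c.index b = i := (index_mid c (hs.trans ha.symm) hb.1 hb.2).trans hs
      simp only [Finset.mem_filter, Finset.mem_univ, true_and]
      exact ⟨hb', hP b a hb' ha hb.2 hPa⟩
    have h3 := Finset.card_le_card h2
    rw [Fin.card_Icc] at h3
    have h4 : (s : ℕ) = c.sizeUpTo i := rfl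
    simp only [hPa, iff_true]
    omega
  · have h2 : (Finset.univ.filter fun b => c.index b = i ∧ P b) ⊆ Finset.Ico s a := by
      intro b hb
      simp only [Finset.mem_filter, Finset.mem_univ, true_and] at hb
      rw [Finset.mem_Ico]
      refine ⟨hmin b hb.1, ?_⟩
      by_contra h
      exact hPa (hP a b ha hb.1 (not_lt.1 h) hb.2)
    have h3 := Finset.card_le_card h2
    rw [Fin.card_Ico] at h3
    have h4 : (s : ℕ) = c.sizeUpTo i := rfl
    simp only [hPa, iff_false]
    omega

/-- The sorting permutation of a colouring carries the blocks of the derived composition to the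
blocks of `α`. -/
theorem Coloring.carriesBlocks {n : ℕ} {lam α : Composition n} (hα : IsPartition α)
    (f : Coloring lam α) :
    CarriesBlocks f.sorting (derived (f.multipartition hα)) α := by
  classical
  have hmono : ∀ a b, lam.index a = lam.index b → a ≤ b →
      α.index (f.sorting a) ≤ α.index (f.sorting b) := by
    intro a b h hab
    rcases hab.eq_or_lt with rfl | hab
    · exact le_rfl
    · exact index_mono α (f.incOn_sorting a b h hab).le
  have key : ∀ a b, a ≤ b → ((derived (f.multipartition hα)).index a =
      (derived (f.multipartition hα)).index b ↔
        α.index (f.sorting a) = α.index (f.sorting b)) := by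
    intro a b hab
    by_cases hlam : lam.index a = lam.index b
    -- In this block of `lam`, the letters that `g` sends to the first `k` blocks of `α` form an
    -- initial segment, whose end is a cut of the derived composition.
    · have hlt : ∀ k : ℕ, ∀ x, lam.index x = lam.index b →
          ((x : ℕ) < lam.sizeUpTo (lam.index b) + (Finset.univ.filter fun y =>
            lam.index y = lam.index b ∧ (α.index (f.sorting y) : ℕ) < k).card ↔
              (α.index (f.sorting x) : ℕ) < k) := by
        intro k x hx
        refine lt_sizeUpTo_add_card_iff lam _ (fun y => (α.index (f.sorting y) : ℕ) < k) ?_ x hx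
        intro y z hy hz hyz h
        exact lt_of_le_of_lt (hmono y z (hy.trans hz.symm) hyz) h
      rw [index_derived_eq_iff _ hab hlam rfl]
      constructor
      · intro h
        by_contra hne
        have h1 := lt_of_le_of_ne (hmono a b hlam hab) hne
        refine h _ ((f.isCut_multipartition hα _ _).2
          ⟨α.index (f.sorting b), (α.index (f.sorting b)).2.le, rfl⟩) ?_ ?_
        · exact (hlt _ a hlam).2 h1
        · rw [← not_lt, hlt _ b rfl]
          exact lt_irrefl _
      · intro h q hq h1 h2
        obtain ⟨k, -, rfl⟩ := (f.isCut_multipartition hα _ _).1 hq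
        rw [hlt k a hlam, h, ← hlt k b rfl] at h1
        exact h1.not_ge h2
    · constructor
      · exact fun h => absurd (index_eq_of_index_derived_eq _ _ _ h) hlam
      · intro h
        rw [← f.apply_index, ← f.apply_index b, h] at hlam
        exact absurd rfl hlam
  refine ⟨fun a b => ?_, fun a b h => f.incOn_sorting a b (index_eq_of_index_derived_eq _ _ _ h)⟩
  rcases le_total a b with h | h
  · exact key a b h
  · rw [eq_comm, key b a h, eq_comm]

/-! ### Projecting the norm basis -/

open Classical in
/-- The projection of `b_α` as a sum over the colourings of the blocks of `α`. -/
theorem projEnd_normElt {n : ℕ} (lam α : Composition n) (hα : IsPartition α) :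
    projEnd lam (normElt α) = ∑ f : Coloring lam α,
      relNorm (parabolic lam) (parabolic (derived (f.multipartition hα)))
        (eta (derived (f.multipartition hα))) := by
  have hlen : ∀ g x : Equiv.Perm (Fin n), IncOn lam g → x ∈ parabolic lam →
      len (g * x) = len g + len x := by
    intro g x hg hx
    rw [← len_inv, mul_inv_rev, len_mul_of_incOn (inv_mem hx) (by rwa [inv_inv]), len_inv, len_inv,
      add_comm]
  have hterm : ∀ g x : Equiv.Perm (Fin n), IncOn lam g → x ∈ parabolic lam →
      projEnd lam (T (g * x)⁻¹ * T (coxeterElt α) * T (g * x)) =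
        T x⁻¹ * projEnd lam (T g⁻¹ * (T (coxeterElt α) * T g)) * T x := by
    intro g x hg hx
    rw [← T_mul_T (hlen g x hg hx), ← T_inv_mul_T_inv (hlen g x hg hx),
      ← projEnd_mem_mul (T_mem_parabolicAlg lam _ (inv_mem hx)),
      ← projEnd_mul_mem (T_mem_parabolicAlg lam _ hx)]
    simp only [mul_assoc]
  rw [normElt, relNorm_eta α ⊤ le_top, map_sum]
  simp only [relNorm_eta _ _ (parabolic_derived_le _)]
  rw [Finset.sum_sigma']
  symm
  -- The pair of a colouring with sorting permutation `g` and `x` corresponds to the term of `g * x`;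
  -- the terms that do not arise in this way vanish.
  refine Finset.sum_of_injOn (fun p => p.1.sorting * p.2) ?_ ?_ ?_ ?_
  · rintro ⟨f, x⟩ hp ⟨f', x'⟩ hp' h
    simp only [Finset.coe_sigma, Set.mem_sigma_iff, Finset.coe_filter, Finset.mem_univ, true_and,
      Set.mem_ofPred_eq, Finset.coe_univ, Set.mem_univ] at hp hp' h
    obtain ⟨rfl, rfl⟩ := Coloring.eq_of_sorting_mul_eq hp.1 hp'.1 h
    rfl
  · rintro ⟨f, x⟩ hp
    simp only [Finset.coe_sigma, Set.mem_sigma_iff, Finset.coe_filter, Finset.mem_univ, true_and,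
      Set.mem_ofPred_eq, Finset.coe_univ, Set.mem_univ, Subgroup.mem_top] at hp ⊢
    exact (lastMax_mul_iff (f.carriesBlocks hα) x).2 hp.2
  · intro y hy hny
    simp only [Finset.mem_filter, Finset.mem_univ, true_and, Subgroup.mem_top] at hy
    by_cases hmono : ∀ a b, α.index a = α.index b → lam.index (y⁻¹ a) = lam.index (y⁻¹ b)
    · exfalso
      apply hny
      obtain ⟨f, hf⟩ := exists_coloring hmono
      refine ⟨⟨f, f.sorting⁻¹ * y⟩, ?_, by simp⟩
      simp only [Finset.coe_sigma, Set.mem_sigma_iff, Finset.coe_filter, Finset.mem_univ, true_and,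
        Set.mem_ofPred_eq, Finset.coe_univ, Set.mem_univ]
      refine ⟨f.sorting_inv_mul_mem hf, ?_⟩
      rw [← lastMax_mul_iff (f.carriesBlocks hα)]
      simpa using hy
    · obtain ⟨u, hu, d, hd, hud⟩ := exists_factorization lam y⁻¹
      obtain ⟨g, rfl⟩ : ∃ g, d = g⁻¹ := ⟨d⁻¹, (inv_inv d).symm⟩
      rw [inv_inv] at hd
      have hyg : y = g * u⁻¹ := by rw [← inv_inv y, hud]; group
      have hidx : ∀ a, lam.index (y⁻¹ a) = lam.index (g⁻¹ a) := by
        intro a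
        rw [hud, Equiv.Perm.mul_apply, (mem_parabolic_iff lam u).1 hu]
      rw [hyg, hterm g _ hd (inv_mem hu), projEnd_eq_zero_of_not_monochromatic hd, mul_zero,
        zero_mul]
      · intro a b hab hb
        rw [← hidx, ← hidx]
        exact index_mono lam (hy a b hab hb)
      · simpa only [hidx] using hmono
  · rintro ⟨f, x⟩ hp
    simp only [Finset.mem_sigma, Finset.mem_filter, Finset.mem_univ, true_and] at hp
    have hcarry := f.carriesBlocks hα
    rw [hterm _ _ f.incOn_sorting hp.1, projEnd_of_monochromatic f.incOn_sorting,
      hcarry.coxeterElt_conj]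
    intro a b hab
    rw [← f.apply_index, ← f.apply_index, apply_inv_apply, apply_inv_apply, hab]

open Classical in
/-- The elements of the symmetric group that conjugate the Coxeter element of the derived
composition to that of `α`
are, uniquely, the products of the sorting permutation of a colouring with multipartition `θ` and an
element of the parabolic subgroup that centralizes the former. -/
theorem card_conjugating_eq {n : ℕ} (lam α : Composition n) (hα : IsPartition α)
    (θ : Multipartition lam) :
    (Finset.univ.filter fun h => h ∈ (⊤ : Subgroup (Equiv.Perm (Fin n))) ∧
        h * coxeterElt (derived θ) * h⁻¹ = coxeterElt α).card =
      (Finset.univ.filter fun f : Coloring lam α => f.multipartition hα = θ).card *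
        (Finset.univ.filter fun h => h ∈ parabolic lam ∧
          h * coxeterElt (derived θ) * h⁻¹ = coxeterElt (derived θ)).card := by
  rw [← Finset.card_product]
  symm
  have hconj : ∀ f : Coloring lam α, f.multipartition hα = θ →
      f.sorting * coxeterElt (derived θ) * f.sorting⁻¹ = coxeterElt α := by
    rintro f rfl
    rw [← (f.carriesBlocks hα).coxeterElt_conj]
    group
  refine Finset.card_bij (fun p _ => p.1.sorting * p.2) ?_ ?_ ?_
  · rintro ⟨f, y⟩ hp
    simp only [Finset.mem_product, Finset.mem_filter, Finset.mem_univ, true_and,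
      Subgroup.mem_top] at hp ⊢
    rw [← hconj f hp.1]
    conv_rhs => rw [← hp.2.2]
    group
  · rintro ⟨f, y⟩ hp ⟨f', y'⟩ hp' h
    simp only [Finset.mem_product, Finset.mem_filter, Finset.mem_univ, true_and] at hp hp' h
    obtain ⟨rfl, rfl⟩ := Coloring.eq_of_sorting_mul_eq hp.2.1 hp'.2.1 h
    rfl
  · intro x hx
    simp only [Finset.mem_filter, Finset.mem_univ, true_and, Subgroup.mem_top] at hx
    have hxidx : ∀ a b, (derived θ).index a = (derived θ).index b ↔
        α.index (x a) = α.index (x b) := by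
      intro a b
      rw [← sameCycle_coxeterElt, ← sameCycle_coxeterElt, ← hx, Equiv.Perm.sameCycle_conj,
        inv_apply_apply, inv_apply_apply]
    obtain ⟨f, hf⟩ := exists_coloring (lam := lam) (α := α) (y := x) (by
      intro a b hab
      apply index_eq_of_index_derived_eq θ
      rw [hxidx, apply_inv_apply, apply_inv_apply, hab])
    have hmem := f.sorting_inv_mul_mem hf
    have hθ : f.multipartition hα = θ := by
      symm
      refine multipartition_eq_of_index hmem fun a b => ?_
      rw [hxidx, (f.carriesBlocks hα).index_iff, Equiv.Perm.mul_apply, Equiv.Perm.mul_apply,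
        apply_inv_apply, apply_inv_apply]
    refine ⟨⟨f, f.sorting⁻¹ * x⟩, ?_, by simp⟩
    simp only [Finset.mem_product, Finset.mem_filter, Finset.mem_univ, true_and]
    refine ⟨hθ, hmem, ?_⟩
    have h1 : f.sorting⁻¹ * x * coxeterElt (derived θ) * (f.sorting⁻¹ * x)⁻¹ =
        f.sorting⁻¹ * (x * coxeterElt (derived θ) * x⁻¹) * f.sorting := by group
    rw [h1, hx, ← hconj f hθ]
    group

open Classical in
/-- The number of colourings with a given multipartition, by the sizes of conjugacy classes. -/
theorem card_coloring_mul {n : ℕ} (lam α : Composition n) (hα : IsPartition α)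
    (θ : Multipartition lam) (hθ : θ ∈ multipartitionsOf lam α) :
    (Finset.univ.filter fun f : Coloring lam α => f.multipartition hα = θ).card *
        (Nat.card (parabolic lam) * (cycleClass α).ncard) =
      Nat.card (Equiv.Perm (Fin n)) * (parabolicClass θ).ncard := by
  have hblocks : ((derived θ).blocks : Multiset ℕ) = (α.blocks : Multiset ℕ) := by
    simpa [multipartitionsOf] using hθ
  have hα' : coxeterElt α ∈ cycleClass α := parts_partition_coxeterElt α
  have h1 := card_eq_ncard_mul_card (parabolic lam) (u := coxeterElt (derived θ))
    (v := coxeterElt (derived θ)) ⟨1, one_mem _, by simp⟩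
  have h2 := card_eq_ncard_mul_card (⊤ : Subgroup (Equiv.Perm (Fin n))) (u := coxeterElt α)
    (v := coxeterElt (derived θ)) (by rw [cycleClass_eq hblocks] at hα'; exact hα')
  rw [← cycleClass_eq hblocks, card_conjugating_eq lam α hα θ, Subgroup.card_top] at h2
  change Nat.card (parabolic lam) = (parabolicClass θ).ncard * _ at h1
  rw [h1, h2]
  ring

end SymHecke

theorem mainTheorem2 (n : ℕ) (lam α : Composition n) (hα : SymHecke.IsPartition α) :
    ((1 : ℚ) ⊗ₜ[ℤ] (SymHecke.proj lam (SymHecke.normElt α) : SymHecke.Hecke n) =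
      ((Nat.card (Equiv.Perm (Fin n)) : ℚ) /
          ((Nat.card (SymHecke.parabolic lam) : ℚ) * ((SymHecke.cycleClass α).ncard : ℚ))) •
        ∑ θ ∈ SymHecke.multipartitionsOf lam α,
          ((SymHecke.parabolicClass θ).ncard : ℚ) •
            ((1 : ℚ) ⊗ₜ[ℤ] SymHecke.relNorm (SymHecke.parabolic lam)
              (SymHecke.parabolic (SymHecke.derived θ)) (SymHecke.eta (SymHecke.derived θ)))) ∧
    (∀ θ ∈ SymHecke.multipartitionsOf lam α,
      Nat.card (SymHecke.parabolic lam) * (SymHecke.cycleClass α).ncard ∣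
        Nat.card (Equiv.Perm (Fin n)) * (SymHecke.parabolicClass θ).ncard) ∧
    (SymHecke.proj lam (SymHecke.normElt α) : SymHecke.Hecke n) =
      ∑ θ ∈ SymHecke.multipartitionsOf lam α,
        (Nat.card (Equiv.Perm (Fin n)) * (SymHecke.parabolicClass θ).ncard /
            (Nat.card (SymHecke.parabolic lam) * (SymHecke.cycleClass α).ncard)) •
          SymHecke.relNorm (SymHecke.parabolic lam)
            (SymHecke.parabolic (SymHecke.derived θ)) (SymHecke.eta (SymHecke.derived θ)) := by
  classical
  set D := Nat.card (SymHecke.parabolic lam) * (SymHecke.cycleClass α).ncard with hD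
  have hDpos : 0 < D := Nat.mul_pos Nat.card_pos ((Set.ncard_pos (Set.toFinite _)).2
    ⟨_, SymHecke.parts_partition_coxeterElt α⟩)
  have hcard := SymHecke.card_coloring_mul lam α hα
  have hint : (SymHecke.proj lam (SymHecke.normElt α) : SymHecke.Hecke n) =
      ∑ θ ∈ SymHecke.multipartitionsOf lam α,
        (Nat.card (Equiv.Perm (Fin n)) * (SymHecke.parabolicClass θ).ncard / D) •
          SymHecke.relNorm (SymHecke.parabolic lam)
            (SymHecke.parabolic (SymHecke.derived θ)) (SymHecke.eta (SymHecke.derived θ)) := by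
    rw [← SymHecke.projEnd_apply, SymHecke.projEnd_normElt lam α hα,
      ← Finset.sum_fiberwise_of_maps_to (s := Finset.univ)
        (t := SymHecke.multipartitionsOf lam α)
        (g := fun f : SymHecke.Coloring lam α => f.multipartition hα)]
    · refine Finset.sum_congr rfl fun θ hθ => ?_
      rw [← hcard θ hθ, Nat.mul_div_cancel _ hDpos, ← Finset.sum_const]
      refine Finset.sum_congr rfl fun f hf => ?_
      rw [(Finset.mem_filter.1 hf).2]
    · intro f _
      simp only [SymHecke.multipartitionsOf, Finset.mem_filter, Finset.mem_univ, true_and]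
      exact f.derived_blocks hα
  refine ⟨?_, fun θ hθ => ⟨_, (hcard θ hθ).symm.trans (mul_comm _ _)⟩, hint⟩
  rw [hint, TensorProduct.tmul_sum, Finset.smul_sum]
  refine Finset.sum_congr rfl fun θ hθ => ?_
  have hD0 : (D : ℚ) ≠ 0 := by exact_mod_cast hDpos.ne'
  have hcoef : (Nat.card (Equiv.Perm (Fin n)) : ℚ) /
      ((Nat.card (SymHecke.parabolic lam) : ℚ) * ((SymHecke.cycleClass α).ncard : ℚ)) *
        ((SymHecke.parabolicClass θ).ncard : ℚ) =
      ((Nat.card (Equiv.Perm (Fin n)) * (SymHecke.parabolicClass θ).ncard / D : ℕ) : ℚ) := by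
    rw [← hcard θ hθ, Nat.mul_div_cancel _ hDpos, div_mul_eq_mul_div, ← Nat.cast_mul,
      ← Nat.cast_mul, ← hcard θ hθ, ← hD, Nat.cast_mul, mul_div_cancel_right₀ _ hD0]
  rw [smul_smul, hcoef, TensorProduct.tmul_smul, Nat.cast_smul_eq_nsmul]
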